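/- A finite poset $P$ is regarded as a game: two players alternately choose a remaining point $x$ and remove all remaining $y\ge x$; a player who cannot move loses. $P$ is an $\exists$-game if the first player has a winning strategy. $P$ is N-free if it has no four elements $a,b,c,d$ with $a<b$, $c<d$, $c<b$ such that the other three pairs are incomparable. Let $\text{N-Free}(\text{Explicit},\text{PO})$ be the following promise problem. Input: a binary string. Promise: the string is the $m\times m$ adjacency matrix (row by row, entry $(i,j)$ equal to $1$ iff $i\le j$) of an N-free partial order $\le$ on $m$ points, for some $m\ge 0$. Question: is this poset an $\exists$-game? Theorem. $\text{N-Free}(\text{Explicit},\text{PO})$ is $\mathbf{NC}^1$-hard under $\mathbf{AC}^0$ reductions. That is, for every language $L\subseteq\{0,1\}^*$ in uniform $\mathbf{NC}^1$ there is a function $f:\{0,1\}^*\to\{0,1\}^*$ in uniform $\mathbf{AC}^0$ such that for every $w\in\{0,1\}^*$ the string $f(w)$ satisfies the promise, and $w\in L$ if and only if the poset described by $f(w)$ is an $\exists$-game. Here $\mathbf{NC}^1$ is the class of languages decided by uniform families of Boolean circuits of polynomial size, depth $O(\log n)$ and fan-in at most two, and $\mathbf{AC}^0$ functions are those computed by uniform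 families of Boolean circuits of polynomial size, constant depth and unbounded fan-in. For $\mathbf{AC}^0$, uniformity means that the direct connection language (gate types, wires, output gates) is first-order definable with the numerical predicates $\le,+,\times,\mathrm{BIT}$ over the numbers below a polynomial in the input length $n$, with $n$ as a parameter. For $\mathbf{NC}^1$ the same is required of the extended connection language (gate types, output gates, and all triples $(g,p,h)$ such that the path $p\in\{\text{left},\text{right}\}^*$ leads from gate $g$ back to gate $h$); this gives $\mathbf{NC}^1=\mathbf{ALOGTIME}$. -/

import Mathlib

namespace PosetGame

/-! ### Poset games -/

section Games

open scoped Classical in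
/-- The player to move wins from the position `S` (the set of remaining points of the poset):
some move `x ∈ S`, which removes all `y ≥ x`, leads to a position that is lost for the player
to move.  A player who cannot move loses. -/
noncomputable def Wins {α : Type*} [PartialOrder α] (S : Finset α) : Prop :=
  ∃ x : {x // x ∈ S}, ¬ Wins (S.filter fun y => ¬ x.1 ≤ y)
termination_by S.card
decreasing_by
  exact Finset.card_lt_card (Finset.filter_ssubset.2 ⟨x.1, x.2, by simp⟩)

/-- A finite poset is an `∃`-game if the first player wins the game that starts with the
whole poset. -/
def IsExistsGame (α : Type*) [PartialOrder α] [Fintype α] : Prop :=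
  Wins (Finset.univ : Finset α)

/-- `α` has no induced subposet `N`: four points with `a < b`, `c < d`, `c < b` and the three
other pairs incomparable. -/
def NFree (α : Type*) [PartialOrder α] : Prop :=
  ¬ ∃ a b c d : α, a < b ∧ c < d ∧ c < b ∧
    IncompRel (· ≤ ·) a c ∧ IncompRel (· ≤ ·) a d ∧ IncompRel (· ≤ ·) b d

end Games

/-! ### The promise problem -/

/-- A promise problem over the binary alphabet: only inputs in `promise` matter, and on these
one asks for membership in `question`. -/
structure PromiseProblem where
  promise : Language Bool
  question : Language Bool

open scoped Classical in
/-- The explicit representation of a partial order on `m` points: the full order relation as an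
`m × m` adjacency matrix, written row by row; the entry `(i, j)` is `true` iff `i ≤ j`. -/
noncomputable def encodeOrder {m : ℕ} (P : PartialOrder (Fin m)) : List Bool :=
  List.ofFn fun k : Fin (m * m) => decide (P.le k.divNat k.modNat)

/-- `N-Free(Explicit, PO)`. -/
def nFreeExplicitPO : PromiseProblem where
  promise := {w | ∃ (m : ℕ) (P : PartialOrder (Fin m)),
    w = encodeOrder P ∧ @NFree (Fin m) P}
  question := {w | ∃ (m : ℕ) (P : PartialOrder (Fin m)),
    w = encodeOrder P ∧ @IsExistsGame (Fin m) P inferInstance}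

/-! ### Boolean circuits -/

/-- A gate of a circuit with `n` inputs and `s` gates, together with its list of predecessors.
The empty conjunction and the empty disjunction are the constants. -/
inductive Gate (n s : ℕ) : Type
  | input (i : Fin n) : Gate n s
  | not (h : Fin s) : Gate n s
  | and (hs : List (Fin s)) : Gate n s
  | or (hs : List (Fin s)) : Gate n s

namespace Gate

/-- The predecessors of a gate. -/
def preds {n s : ℕ} : Gate n s → List (Fin s)
  | input _ => []
  | not h => [h]
  | and hs => hs
  | or hs => hs

/-- The type of a gate as a pair of numbers; the second one is the index of the input bit that
an input gate reads (and `0` for the other gates). -/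
def kind {n s : ℕ} : Gate n s → ℕ × ℕ
  | input i => (0, i)
  | not _ => (1, 0)
  | and _ => (2, 0)
  | or _ => (3, 0)

end Gate

/-- A Boolean circuit with `n` inputs.  The gates are named by the numbers below `size`, and
`outs` lists the output gates.  The function `level` decreases along every wire, so that the
circuit is acyclic and has depth at most `d` if (and, for a suitable `level`, only if) all levels
are at most `d`. -/
structure Circuit (n : ℕ) where
  size : ℕ
  gate : Fin size → Gate n size
  outs : List (Fin size)
  level : Fin size → ℕ
  level_lt : ∀ g h, h ∈ (gate g).preds → level h < level g

namespace Circuit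

variable {n : ℕ}

/-- The value of a gate on the input `x`. -/
def eval (C : Circuit n) (x : Fin n → Bool) (g : Fin C.size) : Bool :=
  match hg : C.gate g with
  | .input i => x i
  | .not h => !(C.eval x h)
  | .and hs => hs.attach.all fun h => C.eval x h.1
  | .or hs => hs.attach.any fun h => C.eval x h.1
termination_by C.level g
decreasing_by
  · exact C.level_lt g h (by simp [hg, Gate.preds])
  · exact C.level_lt g h.1 (by simpa [hg, Gate.preds] using h.2)
  · exact C.level_lt g h.1 (by simpa [hg, Gate.preds] using h.2)

/-- The values of the gates satisfy the expected equations. -/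
theorem eval_eq (C : Circuit n) (x : Fin n → Bool) (g : Fin C.size) :
    C.eval x g = match C.gate g with
      | .input i => x i
      | .not h => !(C.eval x h)
      | .and hs => hs.all (C.eval x)
      | .or hs => hs.any (C.eval x) := by
  rw [eval]
  split <;> rename_i hg <;> rw [hg] <;> simp

/-- The output string of a circuit on the input `x`. -/
def output (C : Circuit n) (x : Fin n → Bool) : List Bool :=
  C.outs.map (C.eval x)

/-- The gate reached from `g` by following a path of directions: `false` leads to the first
predecessor of a gate, `true` leads to the second one. -/
def follow (C : Circuit n) (g : Fin C.size) : List Bool → Option (Fin C.size)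
  | [] => some g
  | b :: π => ((C.gate g).preds[b.toNat]?).bind fun h => C.follow h π

end Circuit

/-- A circuit for every input length. -/
abbrev CircuitFamily : Type := ∀ n : ℕ, Circuit n

namespace CircuitFamily

/-- The string function computed by a family of circuits. -/
def run (F : CircuitFamily) (w : List Bool) : List Bool :=
  (F w.length).output w.get

/-- The number of gates is bounded by a polynomial in the input length. -/
def PolySize (F : CircuitFamily) : Prop :=
  ∃ c : ℕ, ∀ n, (F n).size ≤ (n + 2) ^ c

/-- The circuit for inputs of length `n` has depth at most `d n`. -/
def DepthLE (F : CircuitFamily) (d : ℕ → ℕ) : Prop :=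
  ∀ n g, (F n).level g ≤ d n

/-- All gates have at most two predecessors. -/
def FanInTwo (F : CircuitFamily) : Prop :=
  ∀ n g, ((F n).gate g).preds.length ≤ 2

end CircuitFamily

/-! ### Uniformity -/

/-- The numerical predicates `x ≤ y`, `x + y = z`, `x * y = z` and `BIT` (the bit of `x` in
position `y` is `1`). -/
inductive NumRel : ℕ → Type
  | le : NumRel 2
  | add : NumRel 3
  | mul : NumRel 3
  | bit : NumRel 2

/-- The first-order language of the numerical predicates. -/
def numLanguage : FirstOrder.Language.{0, 0} where
  Functions := fun _ => Empty
  Relations := NumRel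

/-- The initial segment `{0, …, N - 1}` with the standard numerical predicates. -/
instance numStructure (N : ℕ) : numLanguage.Structure (Fin N) where
  funMap := fun f _ => Empty.elim f
  RelMap := fun r v =>
    match r, v with
    | .le, v => (v 0 : ℕ) ≤ v 1
    | .add, v => (v 0 : ℕ) + v 1 = v 2
    | .mul, v => (v 0 : ℕ) * v 1 = v 2
    | .bit, v => Nat.testBit (v 0) (v 1) = true

/-- `R n v` is first-order definable, uniformly in `n`: there is one first-order formula that
defines it, with `n` as a parameter, in the numbers below a fixed polynomial in `n` (equivalently,
in tuples of numbers below `n`).  In particular all `v` with `R n v` are polynomially bounded.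
This is definability in `FO[BIT]`, that is, in the logarithmic-time hierarchy. -/
def FODefinable {k : ℕ} (R : ℕ → (Fin k → ℕ) → Prop) : Prop :=
  ∃ (c : ℕ) (φ : numLanguage.Formula (Fin (k + 1))), ∀ n v,
    R n v ↔ ∃ u : Fin (k + 1) → Fin ((n + 2) ^ (c + 1)),
      (u 0 : ℕ) = n ∧ (∀ i : Fin k, (u i.succ : ℕ) = v i) ∧ φ.Realize u

namespace CircuitFamily

/-- `(g, t, i)`: the gate `g` has the type `(t, i)`. -/
def KindRel (F : CircuitFamily) (n : ℕ) (v : Fin 3 → ℕ) : Prop :=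
  ∃ g : Fin (F n).size,
    v 0 = g ∧ v 1 = ((F n).gate g).kind.1 ∧ v 2 = ((F n).gate g).kind.2

/-- `(g, h)`: the gate `h` is a predecessor of the gate `g`. -/
def WireRel (F : CircuitFamily) (n : ℕ) (v : Fin 2 → ℕ) : Prop :=
  ∃ g h : Fin (F n).size, h ∈ ((F n).gate g).preds ∧ v 0 = g ∧ v 1 = h

/-- `(j, g)`: the output in position `j` is the gate `g`. -/
def OutRel (F : CircuitFamily) (n : ℕ) (v : Fin 2 → ℕ) : Prop :=
  ∃ j : Fin (F n).outs.length, v 0 = j ∧ v 1 = (F n).outs.get j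

/-- A path as a number: its directions are the binary digits behind a leading `1`. -/
def pathCode (π : List Bool) : ℕ :=
  π.foldl (fun a b => 2 * a + b.toNat) 1

/-- `(g, p, h)`: the path with number `p` leads from the gate `g` to the gate `h`. -/
def PathRel (F : CircuitFamily) (n : ℕ) (v : Fin 3 → ℕ) : Prop :=
  ∃ (g h : Fin (F n).size) (π : List Bool),
    (F n).follow g π = some h ∧ v 0 = g ∧ v 1 = pathCode π ∧ v 2 = h

/-- Uniformity in terms of the direct connection language. -/
def Uniform (F : CircuitFamily) : Prop :=
  FODefinable F.KindRel ∧ FODefinable F.WireRel ∧ FODefinable F.OutRel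

/-- Uniformity in terms of the extended connection language, which describes all paths; this is
the usual notion for circuits of logarithmic depth and fan-in two, for which it makes the uniform
class equal to alternating logarithmic time. -/
def ExtUniform (F : CircuitFamily) : Prop :=
  FODefinable F.KindRel ∧ FODefinable F.PathRel ∧ FODefinable F.OutRel

end CircuitFamily

/-! ### Complexity classes and reductions -/

/-- Uniform `NC¹`: languages decided by uniform families of fan-in-two circuits with one output,
of polynomial size and logarithmic depth. -/
def NC1 : Set (Language Bool) :=
  {L | ∃ F : CircuitFamily, F.ExtUniform ∧ F.PolySize ∧ F.FanInTwo ∧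
    (∃ c : ℕ, F.DepthLE fun n => c * Nat.log 2 (n + 2)) ∧
    (∀ n, (F n).outs.length = 1) ∧
    ∀ w : List Bool, w ∈ L ↔ F.run w = [true]}

/-- Uniform `AC⁰` functions: string functions computed by uniform families of circuits of
unbounded fan-in, polynomial size and constant depth. -/
def IsAC0 (f : List Bool → List Bool) : Prop :=
  ∃ F : CircuitFamily, F.Uniform ∧ F.PolySize ∧ (∃ d : ℕ, F.DepthLE fun _ => d) ∧
    ∀ w, F.run w = f w

/-- `L` reduces to the promise problem `A` by an `AC⁰` many-one reduction. -/
def AC0Reduces (L : Language Bool) (A : PromiseProblem) : Prop :=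
  ∃ f : List Bool → List Bool, IsAC0 f ∧
    ∀ w, f w ∈ A.promise ∧ (w ∈ L ↔ f w ∈ A.question)

/-- Hardness of a promise problem for a class of languages under `AC⁰` reductions. -/
def AC0Hard (𝒞 : Set (Language Bool)) (A : PromiseProblem) : Prop :=
  ∀ L ∈ 𝒞, AC0Reduces L A

end PosetGame

/-! A fan-in-two circuit of depth `D = O(log n)` unfolds into a formula of polynomial size whose
nodes are the paths from the output gate. A series-parallel poset, which is N-free, evaluates this
formula through Grundy values: 0 stands for false and 2 for true. Disjoint unions XOR the values
(`grundy_union`), so an extra component of value 2 negates. A nonempty antichain of even size placed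
below a poset applies `skipOne`, which fixes 0 and adds one to every positive value
(`grundy_antichain_below`). This yields disjunction: `x = 2l ⊕ skipOne (skipOne (2r))` is one of 0,
2, 4, 6 and vanishes only if both inputs are false; `x ⊕ skipOne x` is then 0 or 1, and a last
`skipOne` turns 1 into 2 (`or_value`). Conjunction follows by De Morgan.

To keep the order relation simple, the points are the leaves of a complete binary tree, that is, the
numbers below `2 ^ (8 * (D + 1) + 1)`. Two points are related according to the label of their lowest
common ancestor: at a series node the left half lies below the right half, at a parallel node the
halves are incomparable. A gate occupies a block of eight levels, and one digit of each block
records the direction to a predecessor, so the digits of a point spell a path in the circuit.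
Unneeded subtrees are even antichains: they have value 0, and they also serve as the antichains
below series compositions. `grundy_gate` evaluates one block, `grundy_gateTree` the whole tree, and
`valueAt_eq` shows that the unfolded circuit obeys the same recursion.

The input affects only labels of nodes of height 1, and each such label reads at most one bit. Every
matrix entry is therefore a constant or an input bit, and the reducing circuit has no wires at all.
What remains is uniformity: it must be first-order definable which bit or constant an entry is.
`BIT` gives access to the digits of points, the extended connection language finds the gate at the
end of a path, and logarithms are definable. The notion `Def` is closed under connectives, bounded
quantifiers and substitution of `PolyFun`s; `FODefinable.def` and `Def.foDefinable` connect it with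
`FODefinable`. -/

namespace PosetGame

/-! ### Grundy values of poset games -/

section Grundy

variable {α : Type*} [PartialOrder α]

open scoped Classical in
/-- The position after the move `x` from the position `S`. -/
noncomputable def after (S : Finset α) (x : α) : Finset α :=
  S.filter fun y => ¬ x ≤ y

theorem mem_after {S : Finset α} {x y : α} : y ∈ after S x ↔ y ∈ S ∧ ¬ x ≤ y := by
  simp [after]

theorem card_after_lt {S : Finset α} {x : α} (hx : x ∈ S) : (after S x).card < S.card := by
  classical
  exact Finset.card_lt_card (Finset.filter_ssubset.2 ⟨x, hx, by simp⟩)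

/-- The Grundy value of a position: the least number that is not the value of an option. -/
noncomputable def grundy (S : Finset α) : ℕ :=
  sInf {k | ∀ x : {x // x ∈ S}, grundy (after S x.1) ≠ k}
termination_by S.card
decreasing_by exact card_after_lt x.2

theorem grundy_spec (S : Finset α) : ∀ x ∈ S, grundy (after S x) ≠ grundy S := by
  have hne : {k | ∀ x : {x // x ∈ S}, grundy (after S x.1) ≠ k}.Nonempty := by
    have hf : (Set.range fun x : {x // x ∈ S} => grundy (after S x.1)).Finite :=
      Set.finite_range _
    obtain ⟨k, hk⟩ := hf.exists_notMem
    exact ⟨k, fun x hx => hk ⟨x, hx⟩⟩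
  have h := Nat.sInf_mem hne
  intro x hx
  rw [grundy.eq_1 S]
  exact h ⟨x, hx⟩

theorem exists_of_lt_grundy {S : Finset α} {j : ℕ} (hj : j < grundy S) :
    ∃ x ∈ S, grundy (after S x) = j := by
  rw [grundy.eq_1 S] at hj
  have h := Nat.notMem_of_lt_sInf hj
  simp only [Set.mem_ofPred_eq, not_forall, not_not] at h
  obtain ⟨x, hx⟩ := h
  exact ⟨x.1, x.2, hx⟩

theorem grundy_eq {S : Finset α} {k : ℕ} (h1 : ∀ x ∈ S, grundy (after S x) ≠ k)
    (h2 : ∀ j < k, ∃ x ∈ S, grundy (after S x) = j) : grundy S = k := by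
  rcases lt_trichotomy (grundy S) k with h | h | h
  · obtain ⟨x, hx, hxk⟩ := h2 _ h
    exact absurd hxk (grundy_spec S x hx)
  · exact h
  · obtain ⟨x, hx, hxk⟩ := exists_of_lt_grundy h
    exact absurd hxk (h1 x hx)

theorem wins_iff_grundy_ne_zero (S : Finset α) : Wins S ↔ grundy S ≠ 0 := by
  induction hn : S.card using Nat.strong_induction_on generalizing S with
  | _ n ih =>
    subst hn
    rw [Wins]
    constructor
    · rintro ⟨x, hx⟩
      have := (ih _ (card_after_lt x.2) (after S x.1) rfl).not.1 (by simpa [after] using hx)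
      intro h0
      exact grundy_spec S x.1 x.2 (by rw [h0]; simpa using this)
    · intro h
      obtain ⟨x, hx, hx0⟩ := exists_of_lt_grundy (Nat.pos_of_ne_zero h)
      refine ⟨⟨x, hx⟩, ?_⟩
      have := (ih _ (card_after_lt hx) (after S x) rfl).not.2 (by simpa using hx0)
      simpa [after] using this

/-- A move in one component leaves the other one untouched, and any number below the XOR of two
values is obtained by lowering one of them. -/
theorem grundy_union [DecidableEq α] {A B : Finset α}
    (h : ∀ a ∈ A, ∀ b ∈ B, ¬ a ≤ b ∧ ¬ b ≤ a) : grundy (A ∪ B) = grundy A ^^^ grundy B := by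
  induction hn : (A ∪ B).card using Nat.strong_induction_on generalizing A B with
  | _ n ih =>
    subst hn
    have hA : ∀ a ∈ A, grundy (after (A ∪ B) a) = grundy (after A a) ^^^ grundy B := by
      intro a ha
      have e : after (A ∪ B) a = after A a ∪ B := by
        ext y
        simp only [mem_after, Finset.mem_union]
        have := h a ha y
        tauto
      rw [e]
      refine ih _ ?_ (fun x hx b hb => h x (mem_after.1 hx).1 b hb) rfl
      rw [← e]
      exact card_after_lt (Finset.mem_union_left _ ha)
    have hB : ∀ b ∈ B, grundy (after (A ∪ B) b) = grundy A ^^^ grundy (after B b) := by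
      intro b hb
      have e : after (A ∪ B) b = A ∪ after B b := by
        ext y
        simp only [mem_after, Finset.mem_union]
        have := h y
        have := fun hy => (h y hy b hb).2
        tauto
      rw [e]
      refine ih _ ?_ (fun x hx b hb => h x hx b (mem_after.1 hb).1) rfl
      rw [← e]
      exact card_after_lt (Finset.mem_union_right _ hb)
    apply grundy_eq
    · intro x hx
      rcases Finset.mem_union.1 hx with ha | hb
      · rw [hA x ha]
        exact fun h => grundy_spec A x ha (Nat.xor_left_inj.1 h)
      · rw [hB x hb]
        exact fun h => grundy_spec B x hb (Nat.xor_right_inj.1 h)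
    · intro j hj
      rcases Nat.lt_xor_cases hj with h1 | h1
      · obtain ⟨x, hx, he⟩ := exists_of_lt_grundy h1
        exact ⟨x, Finset.mem_union_left _ hx, by rw [hA x hx, he, Nat.xor_assoc]; simp⟩
      · obtain ⟨x, hx, he⟩ := exists_of_lt_grundy h1
        refine ⟨x, Finset.mem_union_right _ hx, ?_⟩
        rw [hB x hx, he, Nat.xor_comm j, ← Nat.xor_assoc]
        simp

theorem grundy_antichain {A : Finset α} (h : ∀ a ∈ A, ∀ b ∈ A, a ≤ b → a = b) :
    grundy A = A.card % 2 := by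
  classical
  induction hn : A.card using Nat.strong_induction_on generalizing A with
  | _ n ih =>
    subst hn
    have hA : ∀ a ∈ A, grundy (after A a) = (A.card - 1) % 2 := by
      intro a ha
      have e : after A a = A.erase a := by
        ext y
        simp only [mem_after, Finset.mem_erase]
        constructor
        · rintro ⟨hy, hn⟩
          exact ⟨fun e => hn e.ge, hy⟩
        · rintro ⟨hne, hy⟩
          exact ⟨hy, fun hle => hne (h a ha y hy hle).symm⟩
      have hc := Finset.card_erase_of_mem ha
      have hpos := Finset.card_pos.2 ⟨a, ha⟩
      rw [e, ih _ (by omega) (fun x hx y hy => h x (Finset.mem_of_mem_erase hx) y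
        (Finset.mem_of_mem_erase hy)) rfl, hc]
    apply grundy_eq
    · intro x hx
      have hpos := Finset.card_pos.2 ⟨x, hx⟩
      rw [hA x hx]
      omega
    · intro j hj
      have hpos : 0 < A.card := by omega
      obtain ⟨x, hx⟩ := Finset.card_pos.1 hpos
      exact ⟨x, hx, by rw [hA x hx]; omega⟩

/-- The enumeration of the numbers different from `1`. -/
def skipOne (x : ℕ) : ℕ := if x = 0 then 0 else x + 1

/-- A move in `A` erases `B` and leaves an odd antichain, of value 1. A move in `B` keeps `A`, so by
induction it contributes a value of `skipOne`, whose range misses exactly 1. -/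
theorem grundy_antichain_below [DecidableEq α] {A B : Finset α}
    (h : ∀ a ∈ A, ∀ b ∈ A, a ≤ b → a = b) (hA : A.Nonempty) (he : Even A.card)
    (hAB : ∀ a ∈ A, ∀ b ∈ B, a < b) : grundy (A ∪ B) = skipOne (grundy B) := by
  induction hn : B.card using Nat.strong_induction_on generalizing B with
  | _ n ih =>
    subst hn
    have h1 : ∀ a ∈ A, grundy (after (A ∪ B) a) = 1 := by
      intro a ha
      have e : after (A ∪ B) a = A.erase a := by
        ext y
        simp only [mem_after, Finset.mem_erase, Finset.mem_union]
        constructor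
        · rintro ⟨hy, hn⟩
          refine ⟨fun e => hn e.ge, hy.resolve_right fun hB => hn (hAB a ha y hB).le⟩
        · rintro ⟨hne, hy⟩
          exact ⟨.inl hy, fun hle => hne (h a ha y hy hle).symm⟩
      have hc := Finset.card_erase_of_mem ha
      have hpos := Finset.card_pos.2 ⟨a, ha⟩
      rw [e, grundy_antichain fun x hx y hy => h x (Finset.mem_of_mem_erase hx) y
        (Finset.mem_of_mem_erase hy), hc]
      obtain ⟨r, hr⟩ := he
      omega
    have h2 : ∀ b ∈ B, grundy (after (A ∪ B) b) = skipOne (grundy (after B b)) := by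
      intro b hb
      have e : after (A ∪ B) b = A ∪ after B b := by
        ext y
        simp only [mem_after, Finset.mem_union]
        have : y ∈ A → ¬ b ≤ y := fun hy => (hAB y hy b hb).not_ge
        tauto
      rw [e]
      exact ih _ (card_after_lt hb) (fun a ha b hb => hAB a ha b (mem_after.1 hb).1) rfl
    apply grundy_eq
    · intro x hx
      rcases Finset.mem_union.1 hx with ha | hb
      · rw [h1 x ha, skipOne]
        split <;> omega
      · rw [h2 x hb, skipOne, skipOne]
        have := grundy_spec B x hb
        split <;> split <;> omega
    · intro j hj
      rcases eq_or_ne j 1 with rfl | hj1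
      · obtain ⟨a, ha⟩ := hA
        exact ⟨a, Finset.mem_union_left _ ha, h1 a ha⟩
      -- `j - 1` is the preimage of `j` under `skipOne`; truncated subtraction covers `j = 0`.
      · have hlt : j - 1 < grundy B := by
          rw [skipOne] at hj
          split at hj <;> omega
        obtain ⟨x, hx, hxe⟩ := exists_of_lt_grundy hlt
        refine ⟨x, Finset.mem_union_right _ hx, ?_⟩
        rw [h2 x hx, hxe, skipOne]
        split <;> omega

theorem grundy_pair [DecidableEq α] {a b : α} (h : a < b) : grundy ({a, b} : Finset α) = 2 := by
  have h1 : grundy (after {a, b} a) = 0 := by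
    have e : after {a, b} a = ∅ := by
      ext y
      simp only [mem_after, Finset.mem_insert, Finset.mem_singleton, Finset.notMem_empty, iff_false]
      rintro ⟨rfl | rfl, h'⟩
      · exact h' le_rfl
      · exact h' h.le
    rw [e, grundy_antichain (by simp)]
    simp
  have h2 : grundy (after {a, b} b) = 1 := by
    have e : after {a, b} b = {a} := by
      ext y
      simp only [mem_after, Finset.mem_insert, Finset.mem_singleton]
      constructor
      · rintro ⟨rfl | rfl, h'⟩
        · rfl
        · exact absurd le_rfl h'
      · rintro rfl
        exact ⟨.inl rfl, h.not_ge⟩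
    rw [e, grundy_antichain (by simp)]
    simp
  apply grundy_eq
  · intro x hx
    rcases Finset.mem_insert.1 hx with rfl | hx
    · omega
    · rw [Finset.mem_singleton.1 hx]
      omega
  · intro j hj
    interval_cases j
    · exact ⟨a, by simp, h1⟩
    · exact ⟨b, by simp, h2⟩

end Grundy

/-! ### Series-parallel orders on the leaves of a complete binary tree -/

section TreeOrder

/-- The strict order on the leaves of a complete binary tree whose inner nodes are series nodes
(where `S` holds) or parallel nodes.  A leaf is given by its bits, the highest bit being read at
the root, and `S t β` is the label of the node at height `t + 1` above the leaf `β`. -/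
def treeLt (S : ℕ → (ℕ → Bool) → Prop) (p q : ℕ → Bool) : Prop :=
  ∃ t, (∀ i, t < i → p i = q i) ∧ p t = false ∧ q t = true ∧ S t p

/-- The label of a node only depends on the bits that lead to it. -/
def IsLabelling (S : ℕ → (ℕ → Bool) → Prop) : Prop :=
  ∀ t β β', (∀ i, t < i → β i = β' i) → S t β → S t β'

variable {S : ℕ → (ℕ → Bool) → Prop}

theorem treeLt_irrefl (p : ℕ → Bool) : ¬ treeLt S p p := by
  rintro ⟨t, -, h1, h2, -⟩
  simp [h1] at h2

/-- The higher of the two separating nodes also separates `p` from `r`, and its label is the same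
seen from `p` or from `q`. -/
theorem treeLt_trans (hS : IsLabelling S) {p q r : ℕ → Bool} (h : treeLt S p q)
    (h' : treeLt S q r) : treeLt S p r := by
  obtain ⟨t, ha, h0, h1, hs⟩ := h
  obtain ⟨t', ha', h0', h1', hs'⟩ := h'
  rcases lt_trichotomy t t' with hlt | rfl | hlt
  · exact ⟨t', fun i hi => (ha i (hlt.trans hi)).trans (ha' i hi), (ha t' hlt).trans h0', h1',
      hS t' q p (fun i hi => (ha i (hlt.trans hi)).symm) hs'⟩
  · simp [h1] at h0'
  · exact ⟨t, fun i hi => (ha i hi).trans (ha' i (hlt.trans hi)), h0, (ha' t hlt).symm.trans h1,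
      hs⟩

/-- Compare the nodes that separate the three pairs. If `a` leaves `b` below the node where `c`
does, then `a` inherits `c < b` from `b`; if above, `c` inherits `a < b`. If at the same node, `a`
and `c` lie on its left side and `b` on its right, and the height at which `c` and `d` separate
yields `b < d`, `a < d` or `d < b`. -/
theorem treeLt_nFree (hS : IsLabelling S) {a b c d : ℕ → Bool} (hab : treeLt S a b)
    (hcd : treeLt S c d) (hcb : treeLt S c b) :
    treeLt S a c ∨ treeLt S c a ∨ treeLt S a d ∨ treeLt S b d ∨ treeLt S d b := by
  obtain ⟨t, h, h0, h1, hs⟩ := hcb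
  obtain ⟨t₁, k, k0, k1, ks⟩ := hab
  obtain ⟨t₂, l, l0, l1, ls⟩ := hcd
  rcases lt_trichotomy t₁ t with hlt | rfl | hlt
  · exact .inr (.inl ⟨t, fun i hi => (h i hi).trans (k i (hlt.trans hi)).symm, h0,
      (k t hlt).trans h1, hs⟩)
  · rcases lt_trichotomy t₁ t₂ with hlt | rfl | hlt
    · exact .inr (.inr (.inr (.inl ⟨t₂, fun i hi => (h i (hlt.trans hi)).symm.trans (l i hi),
        (h t₂ hlt).symm.trans l0, l1,
        hS t₂ c b (fun i hi => h i (hlt.trans hi)) ls⟩)))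
    · exact .inr (.inr (.inl ⟨t₁, fun i hi => ((k i hi).trans (h i hi).symm).trans (l i hi), k0,
        l1, ks⟩))
    · exact .inr (.inr (.inr (.inr ⟨t₁, fun i hi => (l i (hlt.trans hi)).symm.trans (h i hi),
        (l t₁ hlt).symm.trans h0, h1, hS t₁ c d (fun i hi => l i (hlt.trans hi)) hs⟩)))
  · exact .inl ⟨t₁, fun i hi => (k i hi).trans (h i (hlt.trans hi)).symm, k0,
      (h t₁ hlt).trans k1, ks⟩

/-- The points of `α` are the leaves of the complete binary tree of height `H`, with the order
given by the labelling `S`. -/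
structure IsTreeOrder {α : Type*} [PartialOrder α] (H : ℕ) (S : ℕ → (ℕ → Bool) → Prop)
    (bit : α → ℕ → Bool) : Prop where
  labelling : IsLabelling S
  injective : Function.Injective bit
  high : ∀ p i, H ≤ i → bit p i = false
  surj : ∀ β : ℕ → Bool, (∀ i, H ≤ i → β i = false) → ∃ p, bit p = β
  le_iff : ∀ p q, p ≤ q ↔ p = q ∨ treeLt S (bit p) (bit q)

namespace IsTreeOrder

variable {α : Type*} [PartialOrder α] {H : ℕ} {bit : α → ℕ → Bool}

theorem lt_iff (h : IsTreeOrder H S bit) (p q : α) : p < q ↔ treeLt S (bit p) (bit q) := by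
  rw [lt_iff_le_and_ne, h.le_iff]
  constructor
  · rintro ⟨h1 | h1, h2⟩
    · exact absurd h1 h2
    · exact h1
  · intro h1
    refine ⟨.inr h1, ?_⟩
    rintro rfl
    exact treeLt_irrefl _ h1

theorem nFree (h : IsTreeOrder H S bit) : NFree α := by
  rintro ⟨a, b, c, d, hab, hcd, hcb, hac, had, hbd⟩
  rw [h.lt_iff] at hab hcd hcb
  rcases treeLt_nFree h.labelling hab hcd hcb with h1 | h1 | h1 | h1 | h1 <;>
    rw [← h.lt_iff] at h1
  · exact hac.1 h1.le
  · exact hac.2 h1.le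
  · exact had.1 h1.le
  · exact hbd.1 h1.le
  · exact hbd.2 h1.le

end IsTreeOrder

variable {α : Type*} [Fintype α] {H : ℕ} {bit : α → ℕ → Bool}

open scoped Classical in
/-- The leaves below the node at height `t` that the bits of `β` lead to. -/
noncomputable def cyl (bit : α → ℕ → Bool) (t : ℕ) (β : ℕ → Bool) : Finset α :=
  Finset.univ.filter fun p => ∀ i, t ≤ i → bit p i = β i

theorem mem_cyl {t : ℕ} {β : ℕ → Bool} {p : α} :
    p ∈ cyl bit t β ↔ ∀ i, t ≤ i → bit p i = β i := by
  simp [cyl]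

open scoped Classical in
theorem cyl_succ (t : ℕ) (β : ℕ → Bool) :
    cyl bit (t + 1) β =
      cyl bit t (Function.update β t false) ∪ cyl bit t (Function.update β t true) := by
  have key (p : α) (b : Bool) : p ∈ cyl bit t (Function.update β t b) ↔
      p ∈ cyl bit (t + 1) β ∧ bit p t = b := by
    simp only [mem_cyl]
    constructor
    · intro h
      refine ⟨fun i hi => ?_, by simpa using h t le_rfl⟩
      rw [h i (by omega), Function.update_of_ne (by omega)]
    · rintro ⟨h, hb⟩ i hi
      rcases eq_or_ne i t with rfl | hne
      · simpa using hb
      · rw [Function.update_of_ne hne, h i (by omega)]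
  ext p
  rw [Finset.mem_union, key, key]
  cases bit p t <;> simp

variable [PartialOrder α]

namespace IsTreeOrder

/-- Points from the two halves have the node itself as lowest common ancestor, so its label alone
decides. -/
theorem le_iff_of_mem (h : IsTreeOrder H S bit) {t : ℕ} {β : ℕ → Bool} {p q : α}
    (hp : p ∈ cyl bit t (Function.update β t false))
    (hq : q ∈ cyl bit t (Function.update β t true)) :
    (p < q ↔ S t β) ∧ ¬ q ≤ p := by
  rw [mem_cyl] at hp hq
  have hpt : bit p t = false := by simpa using hp t le_rfl
  have hqt : bit q t = true := by simpa using hq t le_rfl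
  have hpi : ∀ i, t < i → bit p i = β i := fun i hi => by
    rw [hp i hi.le, Function.update_of_ne hi.ne']
  have hqi : ∀ i, t < i → bit q i = β i := fun i hi => by
    rw [hq i hi.le, Function.update_of_ne hi.ne']
  have hpq : treeLt S (bit p) (bit q) ↔ S t β := by
    constructor
    · rintro ⟨t', h1, h2, h3, h4⟩
      rcases lt_trichotomy t' t with hlt | rfl | hlt
      · simp [h1 t hlt, hqt] at hpt
      · exact h.labelling _ _ _ hpi h4
      · rw [hpi t' hlt, ← hqi t' hlt, h3] at h2
        simp at h2
    · intro hs
      exact ⟨t, fun i hi => (hpi i hi).trans (hqi i hi).symm, hpt, hqt,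
        h.labelling _ _ _ (fun i hi => (hpi i hi).symm) hs⟩
  refine ⟨(h.lt_iff p q).trans hpq, ?_⟩
  rw [h.le_iff]
  rintro (rfl | ⟨t', h1, h2, h3, h4⟩)
  · simp [hpt] at hqt
  · rcases lt_trichotomy t' t with hlt | rfl | hlt
    · simp [h1 t hlt, hpt] at hqt
    · simp [h3] at hpt
    · rw [hqi t' hlt, ← hpi t' hlt, h3] at h2
      simp at h2

theorem grundy_parallel (h : IsTreeOrder H S bit) {t : ℕ} {β : ℕ → Bool} (hs : ¬ S t β) :
    grundy (cyl bit (t + 1) β) =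
      grundy (cyl bit t (Function.update β t false)) ^^^
        grundy (cyl bit t (Function.update β t true)) := by
  classical
  rw [cyl_succ, grundy_union]
  intro a ha b hb
  have := h.le_iff_of_mem ha hb
  refine ⟨fun hle => ?_, this.2⟩
  exact hs (this.1.1 (lt_of_le_of_ne hle fun e => this.2 e.ge))

/-- All nodes from height `2` up to height `t` are parallel below the given node. -/
def _root_.PosetGame.Quiet (S : ℕ → (ℕ → Bool) → Prop) (t : ℕ) (β : ℕ → Bool) : Prop :=
  ∀ i, 1 ≤ i → i < t → ∀ β', (∀ j, t ≤ j → β' j = β j) → ¬ S i β'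

/-- All nodes below the given node are parallel. -/
def _root_.PosetGame.Dead (S : ℕ → (ℕ → Bool) → Prop) (t : ℕ) (β : ℕ → Bool) : Prop :=
  ∀ i, i < t → ∀ β', (∀ j, t ≤ j → β' j = β j) → ¬ S i β'

theorem dead_antichain (h : IsTreeOrder H S bit) {t : ℕ} {β : ℕ → Bool} (hd : Dead S t β) :
    ∀ a ∈ cyl bit t β, ∀ b ∈ cyl bit t β, a ≤ b → a = b := by
  intro a ha b hb hle
  rcases (h.le_iff a b).1 hle with rfl | ⟨i, h1, h2, h3, h4⟩
  · rfl
  · rw [mem_cyl] at ha hb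
    rcases lt_or_ge i t with hi | hi
    · exact absurd h4 (hd i hi _ ha)
    · rw [ha i hi, ← hb i hi, h3] at h2
      simp at h2

theorem cyl_zero (h : IsTreeOrder H S bit) {β : ℕ → Bool} (hβ : ∀ i, H ≤ i → β i = false) :
    ∃ p, bit p = β ∧ cyl bit 0 β = {p} := by
  obtain ⟨p, hp⟩ := h.surj β hβ
  refine ⟨p, hp, ?_⟩
  ext q
  rw [mem_cyl, Finset.mem_singleton]
  constructor
  · intro hq
    exact h.injective (funext fun i => (hq i (Nat.zero_le i)).trans (congrFun hp i).symm)
  · rintro rfl i -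
    rw [hp]

theorem update_high {t : ℕ} (ht : t < H) {β : ℕ → Bool} (hβ : ∀ i, H ≤ i → β i = false)
    (b : Bool) : ∀ i, H ≤ i → Function.update β t b i = false := fun i hi => by
  rw [Function.update_of_ne (by omega), hβ i hi]

theorem card_cyl (h : IsTreeOrder H S bit) {t : ℕ} (ht : t ≤ H) {β : ℕ → Bool}
    (hβ : ∀ i, H ≤ i → β i = false) : (cyl bit t β).card = 2 ^ t := by
  classical
  induction t generalizing β with
  | zero =>
    obtain ⟨p, -, hp⟩ := h.cyl_zero hβ
    simp [hp]
  | succ t ih =>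
    rw [cyl_succ, Finset.card_union_of_disjoint, ih (by omega) (update_high ht hβ _),
      ih (by omega) (update_high ht hβ _), pow_succ]
    · ring
    · rw [Finset.disjoint_left]
      intro p hp hq
      exact (h.le_iff_of_mem hp hq).2 le_rfl

/-- The antichain has `2 ^ t` points, an even number since `1 ≤ t`. -/
theorem grundy_dead (h : IsTreeOrder H S bit) {t : ℕ} (h1 : 1 ≤ t) (ht : t ≤ H) {β : ℕ → Bool}
    (hβ : ∀ i, H ≤ i → β i = false) (hd : Dead S t β) : grundy (cyl bit t β) = 0 := by
  rw [grundy_antichain (h.dead_antichain hd), h.card_cyl ht hβ]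
  obtain ⟨s, rfl⟩ := Nat.exists_eq_add_of_le h1
  rw [pow_add]
  omega

theorem grundy_parallel_dead (h : IsTreeOrder H S bit) {t : ℕ} {β : ℕ → Bool} (h1 : 1 ≤ t)
    (ht : t < H) (hβ : ∀ i, H ≤ i → β i = false) (hs : ¬ S t β)
    (hd : Dead S t (Function.update β t false)) :
    grundy (cyl bit (t + 1) β) = grundy (cyl bit t (Function.update β t true)) := by
  rw [h.grundy_parallel hs, h.grundy_dead h1 ht.le (update_high ht hβ _) hd, Nat.zero_xor]

theorem grundy_series (h : IsTreeOrder H S bit) {t : ℕ} {β : ℕ → Bool} (h1 : 1 ≤ t)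
    (ht : t < H) (hβ : ∀ i, H ≤ i → β i = false) (hs : S t β)
    (hd : Dead S t (Function.update β t false)) :
    grundy (cyl bit (t + 1) β) = skipOne (grundy (cyl bit t (Function.update β t true))) := by
  classical
  have hc := h.card_cyl ht.le (update_high ht hβ false)
  rw [cyl_succ, grundy_antichain_below (h.dead_antichain hd)]
  · rw [← Finset.card_pos, hc]
    positivity
  · rw [hc]
    exact Nat.even_pow.2 ⟨even_two, by omega⟩
  · intro a ha b hb
    exact (h.le_iff_of_mem ha hb).1.2 hs

-- A switchable constant. The only node that can be a series node is the one of height 1 whose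
-- digits from 1 to `t - 1` vanish. If `c` holds it is a two-point chain, of value 2; the rest is an
-- antichain made of pairs, of value 0.
open scoped Classical in
theorem grundy_quiet (h : IsTreeOrder H S bit) {t : ℕ} (h1 : 1 ≤ t) (ht : t ≤ H) {β : ℕ → Bool}
    (hβ : ∀ i, H ≤ i → β i = false) (hq : Quiet S t β) {c : Prop}
    (h0 : ∀ β', (∀ j, t ≤ j → β' j = β j) →
      (S 0 β' ↔ (∀ j, 1 ≤ j → j < t → β' j = false) ∧ c)) :
    grundy (cyl bit t β) = if c then 2 else 0 := by
  induction t, h1 using Nat.le_induction generalizing β with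
  | base =>
    by_cases hc : c
    · rw [if_pos hc]
      have hs : S 0 β := (h0 β fun _ _ => rfl).2 ⟨fun j h1 h2 => by omega, hc⟩
      obtain ⟨p, hp, ep⟩ := h.cyl_zero (update_high ht hβ false)
      obtain ⟨q, hq, eq⟩ := h.cyl_zero (update_high ht hβ true)
      rw [show 1 = 0 + 1 from rfl, cyl_succ, ep, eq, ← Finset.insert_eq, grundy_pair]
      exact (h.le_iff_of_mem (by rw [ep]; simp) (by rw [eq]; simp)).1.2 hs
    · rw [if_neg hc]
      refine h.grundy_dead le_rfl ht hβ ?_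
      intro i hi β' hβ'
      obtain rfl : i = 0 := by omega
      rw [h0 β' hβ']
      exact fun h => hc h.2
  | succ t h1 ih =>
    have hext {b : Bool} {β' : ℕ → Bool} (hb : ∀ j, t ≤ j → β' j = Function.update β t b j) :
        ∀ j, t + 1 ≤ j → β' j = β j := fun j hj => by
      rw [hb j (by omega), Function.update_of_ne (by omega)]
    rw [h.grundy_parallel (hq t h1 (by omega) β fun _ _ => rfl),
      ih (by omega) (update_high ht hβ _) (fun i hi hit β' hb => hq i hi (by omega) β' (hext hb)),
      h.grundy_dead h1 (by omega) (update_high ht hβ _), Nat.xor_zero]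
    -- The right half has digit `t` equal to 1, so the special node is not there and this half is
    -- dead.
    · intro i hi β' hb
      rcases Nat.eq_zero_or_pos i with rfl | hpos
      · rw [h0 β' (hext hb)]
        rintro ⟨hz, -⟩
        have := hb t le_rfl
        rw [hz t h1 (by omega)] at this
        simp at this
      · exact hq i hpos (by omega) β' (hext hb)
    · intro β' hb
      rw [h0 β' (hext hb)]
      refine and_congr_left fun _ => ⟨fun hz j hj hjt => hz j hj (by omega), fun hz j hj hjt => ?_⟩
      rcases eq_or_ne j t with rfl | hne
      · simpa using hb j le_rfl
      · exact hz j hj (by omega)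

end IsTreeOrder

end TreeOrder

/-! ### The tree that evaluates a formula -/

section GateTree

/-- The bits of the block `e` lead to a copy of a predecessor of a gate. -/
def CopyBlock (β : ℕ → Bool) (e : ℕ) : Prop :=
  β (8 * e + 8) = false ∧ β (8 * e + 7) = true ∧ β (8 * e + 5) = true ∧
    β (8 * e + 3) = true ∧ β (8 * e + 2) = true ∧ β (8 * e + 1) = false

/-- All blocks from `e` up to the block `D` of the root lead to predecessors. -/
def Alive (D e : ℕ) (β : ℕ → Bool) : Prop :=
  ∀ e', e ≤ e' → e' ≤ D → CopyBlock β e'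

/-- The directions that are chosen in the blocks `D, …, e`. -/
def path (D e : ℕ) (β : ℕ → Bool) : List Bool :=
  (List.range (D + 1 - e)).map fun i => β (8 * (D - i) + 4)

theorem path_top (D : ℕ) (β : ℕ → Bool) : path D (D + 1) β = [] := by simp [path]

theorem path_succ {D e : ℕ} (he : e ≤ D) (β : ℕ → Bool) :
    path D e β = path D (e + 1) β ++ [β (8 * e + 4)] := by
  rw [path, show D + 1 - e = (D + 1 - (e + 1)) + 1 by omega, List.range_succ, List.map_append,
    path, List.map_singleton, show D - (D + 1 - (e + 1)) = e by omega]

theorem length_path (D e : ℕ) (β : ℕ → Bool) : (path D e β).length = D + 1 - e := by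
  simp [path]

theorem path_congr {D e : ℕ} {β β' : ℕ → Bool} (h : ∀ j, 8 * e + 1 ≤ j → β' j = β j) :
    path D e β' = path D e β := by
  refine List.map_congr_left fun i hi => h _ ?_
  rw [List.mem_range] at hi
  omega

theorem Alive.congr {D e : ℕ} {β β' : ℕ → Bool} (ha : Alive D e β)
    (h : ∀ j, 8 * e + 1 ≤ j → β' j = β j) : Alive D e β' := by
  intro e' h1 h2
  have := ha e' h1 h2
  unfold CopyBlock at this ⊢
  rw [h, h, h, h, h, h] <;> first | exact this | omega

/-- The inner nodes of the tree from height `2` on that are series nodes.  A block of eight levels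
evaluates `(l ∨ r)` for the two predecessors of a gate. -/
def InnerSeries (D t : ℕ) (β : ℕ → Bool) : Prop :=
  ∃ e ≤ D, Alive D (e + 1) β ∧ β (8 * e + 8) = false ∧
    (t = 8 * e + 7 ∨
      t = 8 * e + 5 ∧ β (8 * e + 7) = true ∧ β (8 * e + 6) = true ∨
      t = 8 * e + 3 ∧ β (8 * e + 7) = true ∧ β (8 * e + 5) = true ∧ β (8 * e + 4) = true ∨
      t = 8 * e + 2 ∧ β (8 * e + 7) = true ∧ β (8 * e + 5) = true ∧ β (8 * e + 4) = true ∧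
        β (8 * e + 3) = true)

/-- The node of height `1` that represents the constant `K` at a gate. -/
def OutConst (D : ℕ) (β : ℕ → Bool) (K : List Bool → Prop) : Prop :=
  ∃ e ≤ D, Alive D (e + 1) β ∧ (∀ i, 1 ≤ i → i < 8 * e + 8 → β i = false) ∧
    β (8 * e + 8) = true ∧ K (path D (e + 1) β)

/-- The node of height `1` that represents the constant `A` at a predecessor of a gate. -/
def PredConst (D : ℕ) (β : ℕ → Bool) (A : List Bool → Bool → Prop) : Prop :=
  ∃ e ≤ D, Alive D (e + 1) β ∧ (∀ i, 1 ≤ i → i < 8 * e + 1 → β i = false) ∧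
    β (8 * e + 8) = false ∧ β (8 * e + 7) = true ∧ β (8 * e + 5) = true ∧
    β (8 * e + 3) = true ∧ β (8 * e + 2) = true ∧ β (8 * e + 1) = true ∧
    A (path D (e + 1) β) (β (8 * e + 4))

/-- The labelling of a tree that evaluates gates of the form `((l ⊕ a) ∨ (r ⊕ a')) ⊕ k`, where
the constants are given by `K` and `A`. -/
def gateLabel (D : ℕ) (K : List Bool → Prop) (A : List Bool → Bool → Prop) (t : ℕ)
    (β : ℕ → Bool) : Prop :=
  InnerSeries D t β ∨ t = 0 ∧ (OutConst D β K ∨ PredConst D β A)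

variable {D : ℕ} {K : List Bool → Prop} {A : List Bool → Bool → Prop}

/-- Every clause for the index `t` reads only digits above `t`. -/
theorem isLabelling_gateLabel : IsLabelling (gateLabel D K A) := by
  rintro t β β' h (⟨e, he, ha, h8, hh⟩ | ⟨rfl, ⟨e, he, ha, hz, h8, hK⟩ |
    ⟨e, he, ha, hz, h8, h7, h5, h3, h2, h1, hA⟩⟩)
  · have ht : t ≤ 8 * e + 7 := by omega
    refine .inl ⟨e, he, ha.congr fun j hj => (h j (by omega)).symm, ?_, ?_⟩
    · rw [← h _ (by omega), h8]
    · rcases hh with rfl | ⟨rfl, hh⟩ | ⟨rfl, hh⟩ | ⟨rfl, hh⟩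
      · exact .inl rfl
      · rw [h _ (by omega), h _ (by omega)] at hh
        exact .inr (.inl ⟨rfl, hh⟩)
      · rw [h _ (by omega), h _ (by omega), h _ (by omega)] at hh
        exact .inr (.inr (.inl ⟨rfl, hh⟩))
      · rw [h _ (by omega), h _ (by omega), h _ (by omega), h _ (by omega)] at hh
        exact .inr (.inr (.inr ⟨rfl, hh⟩))
  · have h' : ∀ i, 1 ≤ i → β' i = β i := fun i hi => (h i hi).symm
    refine .inr ⟨rfl, .inl ⟨e, he, ha.congr fun j hj => h' j (by omega), fun i hi hi' => ?_, ?_, ?_⟩⟩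
    · rw [h' i hi, hz i hi hi']
    · rw [h' _ (by omega), h8]
    · rwa [path_congr fun j hj => h' j (by omega)]
  · have h' : ∀ i, 1 ≤ i → β' i = β i := fun i hi => (h i hi).symm
    refine .inr ⟨rfl, .inr ⟨e, he, ha.congr fun j hj => h' j (by omega), fun i hi hi' => ?_, ?_⟩⟩
    · rw [h' i hi, hz i hi hi']
    · rw [path_congr fun j hj => h' j (by omega), h' _ (by omega), h' _ (by omega),
        h' _ (by omega), h' _ (by omega), h' _ (by omega), h' _ (by omega), h' _ (by omega)]
      exact ⟨h8, h7, h5, h3, h2, h1, hA⟩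

variable {e : ℕ} {β : ℕ → Bool}

/-- Roles of the digits of a block, from the top: 8 separates the disjunction from the constant `K`;
7 applies the outermost `skipOne`; 6 distinguishes the two copies of `x`; 5 applies `skipOne` to the
second copy; 4 is the direction; 3 and 2 apply `skipOne` twice to the right predecessor; 1 separates
the predecessor from the constant `A`. At 7, 5, 3 and 2 the digit 0 leads to an antichain. -/
theorem gateLabel_seven (he : e ≤ D) (ha : Alive D (e + 1) β) (h8 : β (8 * e + 8) = false) :
    gateLabel D K A (8 * e + 7) β :=
  .inl ⟨e, he, ha, h8, .inl rfl⟩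

theorem gateLabel_five (he : e ≤ D) (ha : Alive D (e + 1) β) (h8 : β (8 * e + 8) = false)
    (h7 : β (8 * e + 7) = true) : gateLabel D K A (8 * e + 5) β ↔ β (8 * e + 6) = true := by
  constructor
  · rintro (⟨e', -, -, -, h | ⟨h, h'⟩ | ⟨h, h'⟩ | ⟨h, h'⟩⟩ | ⟨h, -⟩)
    any_goals omega
    obtain rfl : e = e' := by omega
    exact h'.2
  · exact fun h => .inl ⟨e, he, ha, h8, .inr (.inl ⟨rfl, h7, h⟩)⟩

theorem gateLabel_three (he : e ≤ D) (ha : Alive D (e + 1) β) (h8 : β (8 * e + 8) = false)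
    (h7 : β (8 * e + 7) = true) (h5 : β (8 * e + 5) = true) :
    gateLabel D K A (8 * e + 3) β ↔ β (8 * e + 4) = true := by
  constructor
  · rintro (⟨e', -, -, -, h | ⟨h, h'⟩ | ⟨h, h'⟩ | ⟨h, h'⟩⟩ | ⟨h, -⟩)
    any_goals omega
    obtain rfl : e = e' := by omega
    exact h'.2.2
  · exact fun h => .inl ⟨e, he, ha, h8, .inr (.inr (.inl ⟨rfl, h7, h5, h⟩))⟩

theorem gateLabel_two (he : e ≤ D) (ha : Alive D (e + 1) β) (h8 : β (8 * e + 8) = false)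
    (h7 : β (8 * e + 7) = true) (h5 : β (8 * e + 5) = true) (h3 : β (8 * e + 3) = true) :
    gateLabel D K A (8 * e + 2) β ↔ β (8 * e + 4) = true := by
  constructor
  · rintro (⟨e', -, -, -, h | ⟨h, h'⟩ | ⟨h, h'⟩ | ⟨h, h'⟩⟩ | ⟨h, -⟩)
    any_goals omega
    obtain rfl : e = e' := by omega
    exact h'.2.2.1
  · exact fun h => .inl ⟨e, he, ha, h8, .inr (.inr (.inr ⟨rfl, h7, h5, h, h3⟩))⟩

theorem not_gateLabel (r : ℕ) (hr : r = 1 ∨ r = 4 ∨ r = 6 ∨ r = 8) :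
    ¬ gateLabel D K A (8 * e + r) β := by
  rintro (⟨e', -, -, -, h | ⟨h, h'⟩ | ⟨h, h'⟩ | ⟨h, h'⟩⟩ | ⟨h, -⟩) <;> omega

/-- Blocks above `e` cannot lead to a constant if they lead to predecessors. -/
theorem OutConst.block_le (ha : Alive D (e + 1) β) (h : OutConst D β K) :
    ∃ e' ≤ e, Alive D (e' + 1) β ∧ (∀ i, 1 ≤ i → i < 8 * e' + 8 → β i = false) ∧
      β (8 * e' + 8) = true ∧ K (path D (e' + 1) β) := by
  obtain ⟨e', he', h1, h2, h3, h4⟩ := h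
  refine ⟨e', ?_, h1, h2, h3, h4⟩
  by_contra hlt
  have := (ha e' (by omega) he').1
  simp [h3] at this

theorem PredConst.block_le (ha : Alive D (e + 1) β) (h : PredConst D β A) :
    ∃ e' ≤ e, Alive D (e' + 1) β ∧ (∀ i, 1 ≤ i → i < 8 * e' + 1 → β i = false) ∧
      β (8 * e' + 8) = false ∧ β (8 * e' + 7) = true ∧ β (8 * e' + 5) = true ∧
      β (8 * e' + 3) = true ∧ β (8 * e' + 2) = true ∧ β (8 * e' + 1) = true ∧
      A (path D (e' + 1) β) (β (8 * e' + 4)) := by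
  obtain ⟨e', he', h1, h2, h3⟩ := h
  refine ⟨e', ?_, h1, h2, h3⟩
  by_contra hlt
  have := (ha e' (by omega) he').2.2.2.2.2
  simp [h3.2.2.2.2.2.1] at this

/-- The zero digit violates `CopyBlock`, so no lower block carries labels. Within block `e`, each
clause for a smaller height wants this digit, or digit 8, to be 1. -/
theorem dead_gateLabel (he : e ≤ D) (ha : Alive D (e + 1) β) (h8 : β (8 * e + 8) = false) {t : ℕ}
    (ht : t = 8 * e + 7 ∨ t = 8 * e + 5 ∨ t = 8 * e + 3 ∨ t = 8 * e + 2) (h : β t = false) :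
    Dead (gateLabel D K A) t β := by
  intro i hi β' hβ'
  have ht8 : t < 8 * e + 8 := by omega
  have ha' : Alive D (e + 1) β' := ha.congr fun j hj => hβ' j (by omega)
  have h8' : β' (8 * e + 8) = false := by rw [hβ' _ (by omega), h8]
  have h' : β' t = false := by rw [hβ' t le_rfl, h]
  have hcopy : ¬ CopyBlock β' e := by
    rintro ⟨-, h7, h5, h3, h2, -⟩
    rcases ht with rfl | rfl | rfl | rfl <;> simp_all
  rintro (⟨e', he', h1, h2, h3⟩ | ⟨rfl, h1 | h1⟩)
  · have hle : e' ≤ e := by omega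
    rcases hle.lt_or_eq with hlt | rfl
    · exact hcopy (h1 e (by omega) he)
    · rcases h3 with h3 | ⟨h3, h4⟩ | ⟨h3, h4⟩ | ⟨h3, h4⟩ <;>
        rcases ht with rfl | rfl | rfl | rfl <;> first | omega | simp_all
  · obtain ⟨e', hle, h1, h2, h3, -⟩ := h1.block_le ha'
    rcases hle.lt_or_eq with hlt | rfl
    · exact hcopy (h1 e (by omega) he)
    · simp_all
  · obtain ⟨e', hle, h1, h2, h3⟩ := h1.block_le ha'
    rcases hle.lt_or_eq with hlt | rfl
    · exact hcopy (h1 e (by omega) he)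
    · rcases ht with rfl | rfl | rfl | rfl <;> simp_all

theorem quiet_outConst (he : e ≤ D) (h8 : β (8 * e + 8) = true) :
    Quiet (gateLabel D K A) (8 * e + 8) β := by
  rintro i hi1 hi β' hβ' (⟨e', he', h1, h2, h3⟩ | ⟨rfl, -⟩)
  · have hle : e' ≤ e := by omega
    have h8' := hβ' (8 * e + 8) le_rfl
    rcases hle.lt_or_eq with hlt | rfl
    · have := (h1 e (by omega) he).1
      simp_all
    · simp_all
  · omega

/-- Together with `quiet_outConst` this makes the half with digit 8 set an instance of
`grundy_quiet`. Block `e` is no `CopyBlock`, so no constant of a lower block interferes. -/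
theorem gateLabel_zero_outConst (he : e ≤ D) (ha : Alive D (e + 1) β)
    (h8 : β (8 * e + 8) = true) (β' : ℕ → Bool) (hβ' : ∀ j, 8 * e + 8 ≤ j → β' j = β j) :
    gateLabel D K A 0 β' ↔
      (∀ j, 1 ≤ j → j < 8 * e + 8 → β' j = false) ∧ K (path D (e + 1) β) := by
  have ha' : Alive D (e + 1) β' := ha.congr fun j hj => hβ' j (by omega)
  have hp : path D (e + 1) β' = path D (e + 1) β := path_congr fun j hj => hβ' j (by omega)
  have h8' : β' (8 * e + 8) = true := by rw [hβ' _ le_rfl, h8]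
  have hcopy : ¬ CopyBlock β' e := fun h => by simp [h.1] at h8'
  constructor
  · rintro (⟨e', he', h1, h2, h3⟩ | ⟨-, h1 | h1⟩)
    · omega
    · obtain ⟨e', hle, h1, h2, h3, h4⟩ := h1.block_le ha'
      rcases hle.lt_or_eq with hlt | rfl
      · exact absurd (h1 e (by omega) he) hcopy
      · exact ⟨h2, hp ▸ h4⟩
    · obtain ⟨e', hle, h1, h2, h3, -⟩ := h1.block_le ha'
      rcases hle.lt_or_eq with hlt | rfl
      · exact absurd (h1 e (by omega) he) hcopy
      · simp [h3] at h8'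
  · rintro ⟨h1, h2⟩
    exact .inr ⟨rfl, .inl ⟨e, he, ha', h1, h8', hp ▸ h2⟩⟩

theorem quiet_predConst (he : e ≤ D) (h1 : β (8 * e + 1) = true) :
    Quiet (gateLabel D K A) (8 * e + 1) β := by
  rintro i hi1 hi β' hβ' (⟨e', he', h2, h3, h4⟩ | ⟨rfl, -⟩)
  · have h1' := hβ' (8 * e + 1) le_rfl
    have := (h2 e (by omega) he).2.2.2.2.2
    simp_all
  · omega

theorem gateLabel_zero_predConst (he : e ≤ D) (ha : Alive D (e + 1) β)
    (h8 : β (8 * e + 8) = false) (h7 : β (8 * e + 7) = true) (h5 : β (8 * e + 5) = true)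
    (h3 : β (8 * e + 3) = true) (h2 : β (8 * e + 2) = true) (h1 : β (8 * e + 1) = true)
    (β' : ℕ → Bool) (hβ' : ∀ j, 8 * e + 1 ≤ j → β' j = β j) :
    gateLabel D K A 0 β' ↔ (∀ j, 1 ≤ j → j < 8 * e + 1 → β' j = false) ∧
      A (path D (e + 1) β) (β (8 * e + 4)) := by
  have ha' : Alive D (e + 1) β' := ha.congr fun j hj => hβ' j (by omega)
  have hp : path D (e + 1) β' = path D (e + 1) β := path_congr fun j hj => hβ' j (by omega)
  have h1' : β' (8 * e + 1) = true := by rw [hβ' _ le_rfl, h1]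
  have hcopy : ¬ CopyBlock β' e := fun h => by simp [h.2.2.2.2.2] at h1'
  constructor
  · rintro (⟨e', he', h1, h2, h3⟩ | ⟨-, h4 | h4⟩)
    · omega
    · obtain ⟨e', hle, h4, h5, h6, -⟩ := h4.block_le ha'
      rcases hle.lt_or_eq with hlt | rfl
      · exact absurd (h4 e (by omega) he) hcopy
      · rw [hβ' _ (by omega), h8] at h6
        simp at h6
    · obtain ⟨e', hle, h4, hz, h6⟩ := h4.block_le ha'
      rcases hle.lt_or_eq with hlt | rfl
      · exact absurd (h4 e (by omega) he) hcopy
      · refine ⟨hz, ?_⟩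
        rw [← hp, ← hβ' _ (by omega)]
        exact h6.2.2.2.2.2.2
  · rintro ⟨hz, hA⟩
    refine .inr ⟨rfl, .inr ⟨e, he, ha', hz, ?_⟩⟩
    rw [hp, hβ' _ (by omega), hβ' _ (by omega), hβ' _ (by omega), hβ' _ (by omega),
      hβ' _ (by omega), hβ' _ (by omega), hβ' _ (by omega)]
    exact ⟨h8, h7, h5, h3, h2, h1, hA⟩

/-! ### Grundy value of a block and of the whole tree -/

section Value

variable {α : Type*} [Fintype α] [PartialOrder α] {bit : α → ℕ → Bool} {H : ℕ}

theorem Alive.update (ha : Alive D (e + 1) β) {r : ℕ} (hr : r ≤ 8) (b : Bool) :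
    Alive D (e + 1) (Function.update β (8 * e + r) b) :=
  ha.congr fun j hj => Function.update_of_ne (by omega) _ _

theorem path_update {r : ℕ} (hr : r ≤ 8) (b : Bool) :
    path D (e + 1) (Function.update β (8 * e + r) b) = path D (e + 1) β :=
  path_congr fun j hj => Function.update_of_ne (by omega) _ _

theorem update_block_ne {r r' : ℕ} (hr : r ≠ r') (b : Bool) :
    Function.update β (8 * e + r) b (8 * e + r') = β (8 * e + r') :=
  Function.update_of_ne (by omega) _ _

-- Digit 1 splits off the constant `A`, whose XOR negates the predecessor where needed.
open scoped Classical in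
theorem grundy_pred (h : IsTreeOrder H (gateLabel D K A) bit) (hH : H = 8 * (D + 1) + 1)
    (he : e ≤ D) (hβ : ∀ i, H ≤ i → β i = false) (ha : Alive D (e + 1) β)
    (h8 : β (8 * e + 8) = false) (h7 : β (8 * e + 7) = true) (h5 : β (8 * e + 5) = true)
    (h3 : β (8 * e + 3) = true) (h2 : β (8 * e + 2) = true) :
    grundy (cyl bit (8 * e + 2) β) =
      grundy (cyl bit (8 * e + 1) (Function.update β (8 * e + 1) false)) ^^^
        if A (path D (e + 1) β) (β (8 * e + 4)) then 2 else 0 := by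
  rw [show 8 * e + 2 = 8 * e + 1 + 1 from rfl, h.grundy_parallel (not_gateLabel 1 (by omega))]
  congr 1
  refine h.grundy_quiet (by omega) (by omega) (IsTreeOrder.update_high (by omega) hβ _)
    (quiet_predConst he (by simp)) fun β' hβ' => ?_
  rw [gateLabel_zero_predConst he (ha.update (r := 1) (by omega) true) _ _ _ _ _ _ β' hβ',
    path_update (r := 1) (by omega), update_block_ne (by omega)] <;>
  simp [*]

open scoped Classical in
theorem grundy_copy (h : IsTreeOrder H (gateLabel D K A) bit) (hH : H = 8 * (D + 1) + 1)
    (he : e ≤ D) {val : List Bool → Bool}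
    (ih : ∀ β : ℕ → Bool, (∀ i, H ≤ i → β i = false) → Alive D e β →
      grundy (cyl bit (8 * e + 1) β) = 2 * (val (path D e β)).toNat)
    (hβ : ∀ i, H ≤ i → β i = false) (ha : Alive D (e + 1) β)
    (h8 : β (8 * e + 8) = false) (h7 : β (8 * e + 7) = true) (h5 : β (8 * e + 5) = true)
    (h3 : β (8 * e + 3) = true) (h2 : β (8 * e + 2) = true) :
    grundy (cyl bit (8 * e + 2) β) =
      2 * (val (path D (e + 1) β ++ [β (8 * e + 4)]) ^^
        decide (A (path D (e + 1) β) (β (8 * e + 4)))).toNat := by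
  rw [grundy_pred h hH he hβ ha h8 h7 h5 h3 h2, ih _ (IsTreeOrder.update_high (by omega) hβ _),
    path_succ he, path_update (r := 1) (by omega), update_block_ne (by omega)]
  · cases val (path D (e + 1) β ++ [β (8 * e + 4)]) <;> split <;> simp [*]
  · intro e' h1 h1'
    rcases h1.lt_or_eq with hlt | rfl
    · exact ha.update (r := 1) (by omega) _ e' hlt h1'
    · simp [CopyBlock, *]

-- This is the `x` of the disjunction. The two series nodes move the right input from 2 to 4, so
-- that the XOR vanishes only if both inputs are false.
open scoped Classical in
theorem grundy_copies (h : IsTreeOrder H (gateLabel D K A) bit) (hH : H = 8 * (D + 1) + 1)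
    (he : e ≤ D) {val : List Bool → Bool}
    (ih : ∀ β : ℕ → Bool, (∀ i, H ≤ i → β i = false) → Alive D e β →
      grundy (cyl bit (8 * e + 1) β) = 2 * (val (path D e β)).toNat)
    (hβ : ∀ i, H ≤ i → β i = false) (ha : Alive D (e + 1) β)
    (h8 : β (8 * e + 8) = false) (h7 : β (8 * e + 7) = true) (h5 : β (8 * e + 5) = true) :
    grundy (cyl bit (8 * e + 5) β) =
      2 * (val (path D (e + 1) β ++ [false]) ^^ decide (A (path D (e + 1) β) false)).toNat ^^^
        skipOne (skipOne
          (2 * (val (path D (e + 1) β ++ [true]) ^^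
            decide (A (path D (e + 1) β) true)).toNat)) := by
  rw [show 8 * e + 5 = 8 * e + 4 + 1 from rfl, h.grundy_parallel (not_gateLabel 4 (by omega))]
  congr 1
  · set β₁ := Function.update β (8 * e + 4) false with e₁
    have a₁ : Alive D (e + 1) β₁ := ha.update (r := 4) (by omega) _
    have k₁ : ∀ i, H ≤ i → β₁ i = false := IsTreeOrder.update_high (by omega) hβ _
    have p₁ : path D (e + 1) β₁ = path D (e + 1) β := path_update (r := 4) (by omega) _
    have b8 : β₁ (8 * e + 8) = false := by simp [e₁, h8]
    have b7 : β₁ (8 * e + 7) = true := by simp [e₁, h7]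
    have b5 : β₁ (8 * e + 5) = true := by simp [e₁, h5]
    have b4 : β₁ (8 * e + 4) = false := by simp [e₁]
    rw [show 8 * e + 4 = 8 * e + 3 + 1 from rfl, h.grundy_parallel_dead (by omega) (by omega) k₁
      (by rw [gateLabel_three he a₁ b8 b7 b5, b4]; simp)
      (dead_gateLabel he (a₁.update (r := 3) (by omega) _) (by simp [b8]) (by omega) (by simp))]
    set β₂ := Function.update β₁ (8 * e + 3) true with e₂
    have a₂ : Alive D (e + 1) β₂ := a₁.update (r := 3) (by omega) _
    have k₂ : ∀ i, H ≤ i → β₂ i = false := IsTreeOrder.update_high (by omega) k₁ _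
    have p₂ : path D (e + 1) β₂ = path D (e + 1) β :=
      (path_update (r := 3) (by omega) _).trans p₁
    rw [show 8 * e + 3 = 8 * e + 2 + 1 from rfl, h.grundy_parallel_dead (by omega) (by omega) k₂
      (by rw [gateLabel_two he a₂] <;> simp [*])
      (dead_gateLabel he (a₂.update (r := 2) (by omega) _) (by simp [e₂, b8]) (by omega)
        (by simp)),
      grundy_copy h hH he ih (IsTreeOrder.update_high (by omega) k₂ _)
        (a₂.update (r := 2) (by omega) _), path_update (r := 2) (by omega), p₂]
    all_goals simp [*]
  · set β₁ := Function.update β (8 * e + 4) true with e₁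
    have a₁ : Alive D (e + 1) β₁ := ha.update (r := 4) (by omega) _
    have k₁ : ∀ i, H ≤ i → β₁ i = false := IsTreeOrder.update_high (by omega) hβ _
    have p₁ : path D (e + 1) β₁ = path D (e + 1) β := path_update (r := 4) (by omega) _
    have b8 : β₁ (8 * e + 8) = false := by simp [e₁, h8]
    have b7 : β₁ (8 * e + 7) = true := by simp [e₁, h7]
    have b5 : β₁ (8 * e + 5) = true := by simp [e₁, h5]
    have b4 : β₁ (8 * e + 4) = true := by simp [e₁]
    rw [show 8 * e + 4 = 8 * e + 3 + 1 from rfl, h.grundy_series (by omega) (by omega) k₁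
      (by rw [gateLabel_three he a₁ b8 b7 b5, b4])
      (dead_gateLabel he (a₁.update (r := 3) (by omega) _) (by simp [b8]) (by omega) (by simp))]
    set β₂ := Function.update β₁ (8 * e + 3) true with e₂
    have a₂ : Alive D (e + 1) β₂ := a₁.update (r := 3) (by omega) _
    have k₂ : ∀ i, H ≤ i → β₂ i = false := IsTreeOrder.update_high (by omega) k₁ _
    have p₂ : path D (e + 1) β₂ = path D (e + 1) β :=
      (path_update (r := 3) (by omega) _).trans p₁
    rw [show 8 * e + 3 = 8 * e + 2 + 1 from rfl, h.grundy_series (by omega) (by omega) k₂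
      (by rw [gateLabel_two he a₂] <;> simp [*])
      (dead_gateLabel he (a₂.update (r := 2) (by omega) _) (by simp [e₂, b8]) (by omega)
        (by simp)),
      grundy_copy h hH he ih (IsTreeOrder.update_high (by omega) k₂ _)
        (a₂.update (r := 2) (by omega) _), path_update (r := 2) (by omega), p₂]
    all_goals simp [*]

/-- For even `x ≠ 0`, the numbers `x` and `skipOne x = x + 1` differ exactly in the lowest binary
digit. -/
theorem or_value (l r k : Bool) :
    skipOne ((2 * l.toNat ^^^ skipOne (skipOne (2 * r.toNat))) ^^^
      skipOne (2 * l.toNat ^^^ skipOne (skipOne (2 * r.toNat)))) ^^^ 2 * k.toNat =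
    2 * ((l || r) ^^ k).toNat := by
  cases l <;> cases r <;> cases k <;> decide

-- The XOR of `x` with `skipOne x` needs `x` twice. Digit 6, which `CopyBlock` ignores,
-- distinguishes two copies of the same subformula, so both predecessors are unfolded twice.
open scoped Classical in
theorem grundy_gate (h : IsTreeOrder H (gateLabel D K A) bit) (hH : H = 8 * (D + 1) + 1)
    (he : e ≤ D) {val : List Bool → Bool}
    (ih : ∀ β : ℕ → Bool, (∀ i, H ≤ i → β i = false) → Alive D e β →
      grundy (cyl bit (8 * e + 1) β) = 2 * (val (path D e β)).toNat)
    (hβ : ∀ i, H ≤ i → β i = false) (ha : Alive D (e + 1) β) :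
    grundy (cyl bit (8 * e + 9) β) =
      2 * (((val (path D (e + 1) β ++ [false]) ^^ decide (A (path D (e + 1) β) false)) ||
        (val (path D (e + 1) β ++ [true]) ^^ decide (A (path D (e + 1) β) true))) ^^
          decide (K (path D (e + 1) β))).toNat := by
  rw [show 8 * e + 9 = 8 * e + 8 + 1 from rfl, h.grundy_parallel (not_gateLabel 8 (by omega)),
    ← or_value]
  congr 1
  · set β₁ := Function.update β (8 * e + 8) false with e₁
    have a₁ : Alive D (e + 1) β₁ := ha.update (r := 8) (by omega) _
    have k₁ : ∀ i, H ≤ i → β₁ i = false := IsTreeOrder.update_high (by omega) hβ _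
    have p₁ : path D (e + 1) β₁ = path D (e + 1) β := path_update (r := 8) (by omega) _
    have b8 : β₁ (8 * e + 8) = false := by simp [e₁]
    rw [show 8 * e + 8 = 8 * e + 7 + 1 from rfl, h.grundy_series (by omega) (by omega) k₁
      (gateLabel_seven he a₁ b8)
      (dead_gateLabel he (a₁.update (r := 7) (by omega) _) (by simp [b8]) (by omega) (by simp))]
    set β₂ := Function.update β₁ (8 * e + 7) true with e₂
    have a₂ : Alive D (e + 1) β₂ := a₁.update (r := 7) (by omega) _
    have k₂ : ∀ i, H ≤ i → β₂ i = false := IsTreeOrder.update_high (by omega) k₁ _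
    have p₂ : path D (e + 1) β₂ = path D (e + 1) β :=
      (path_update (r := 7) (by omega) _).trans p₁
    have c8 : β₂ (8 * e + 8) = false := by simp [e₂, b8]
    have c7 : β₂ (8 * e + 7) = true := by simp [e₂]
    rw [show 8 * e + 7 = 8 * e + 6 + 1 from rfl, h.grundy_parallel (not_gateLabel 6 (by omega))]
    congr 2
    · set β₃ := Function.update β₂ (8 * e + 6) false with e₃
      have a₃ : Alive D (e + 1) β₃ := a₂.update (r := 6) (by omega) _
      have k₃ : ∀ i, H ≤ i → β₃ i = false := IsTreeOrder.update_high (by omega) k₂ _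
      have p₃ : path D (e + 1) β₃ = path D (e + 1) β :=
        (path_update (r := 6) (by omega) _).trans p₂
      rw [show 8 * e + 6 = 8 * e + 5 + 1 from rfl, h.grundy_parallel_dead (by omega) (by omega) k₃
        (by rw [gateLabel_five he a₃] <;> simp [*])
        (dead_gateLabel he (a₃.update (r := 5) (by omega) _) (by simp [e₃, c8]) (by omega)
          (by simp)),
        grundy_copies h hH he ih (IsTreeOrder.update_high (by omega) k₃ _)
          (a₃.update (r := 5) (by omega) _), path_update (r := 5) (by omega), p₃]
      all_goals simp [*]
    · set β₃ := Function.update β₂ (8 * e + 6) true with e₃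
      have a₃ : Alive D (e + 1) β₃ := a₂.update (r := 6) (by omega) _
      have k₃ : ∀ i, H ≤ i → β₃ i = false := IsTreeOrder.update_high (by omega) k₂ _
      have p₃ : path D (e + 1) β₃ = path D (e + 1) β :=
        (path_update (r := 6) (by omega) _).trans p₂
      rw [show 8 * e + 6 = 8 * e + 5 + 1 from rfl, h.grundy_series (by omega) (by omega) k₃
        (by rw [gateLabel_five he a₃] <;> simp [*])
        (dead_gateLabel he (a₃.update (r := 5) (by omega) _) (by simp [e₃, c8]) (by omega)
          (by simp)),
        grundy_copies h hH he ih (IsTreeOrder.update_high (by omega) k₃ _)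
          (a₃.update (r := 5) (by omega) _), path_update (r := 5) (by omega), p₃]
      all_goals simp [*]
  · rw [h.grundy_quiet (c := K (path D (e + 1) β)) (by omega) (by omega)
      (IsTreeOrder.update_high (by omega) hβ _) (quiet_outConst he (by simp)) fun β' hβ' => ?_]
    · split <;> simp [*]
    · rw [gateLabel_zero_outConst he (ha.update (r := 8) (by omega) true) (by simp) β' hβ',
        path_update (r := 8) (by omega)]

open scoped Classical in
/-- The Grundy value of the tree is the value of the formula that it unfolds. -/
theorem grundy_gateTree (h : IsTreeOrder H (gateLabel D K A) bit) (hH : H = 8 * (D + 1) + 1)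
    {val : List Bool → Bool} (h0 : ∀ π, π.length = D + 1 → val π = false)
    (h1 : ∀ π, π.length ≤ D → val π =
      (((val (π ++ [false]) ^^ decide (A π false)) || (val (π ++ [true]) ^^ decide (A π true))) ^^
        decide (K π))) :
    grundy (Finset.univ : Finset α) = 2 * (val []).toNat := by
  -- Here `e` is the number of blocks below the node; `e = D + 1` is the root.
  have key : ∀ e ≤ D + 1, ∀ β : ℕ → Bool, (∀ i, H ≤ i → β i = false) → Alive D e β →
      grundy (cyl bit (8 * e + 1) β) = 2 * (val (path D e β)).toNat := by
    intro e
    induction e with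
    | zero =>
      intro _ β hβ ha
      rw [h0 _ (length_path D 0 β)]
      -- A label of height 1 needs a block with digit 8 or digit 1 set, but all blocks up to the
      -- root are `CopyBlock`s.
      refine h.grundy_dead le_rfl (by omega) hβ ?_
      rintro i hi β' hβ' (⟨e', he', h1, h2, h3⟩ | ⟨-, ⟨e', he', h1, h2, h3, -⟩ |
        ⟨e', he', h1, h2, h3⟩⟩)
      · omega
      · have := (ha e' (by omega) he').1
        rw [← hβ' _ (by omega), h3] at this
        simp at this
      · have := (ha e' (by omega) he').2.2.2.2.2
        rw [← hβ' _ (by omega), h3.2.2.2.2.2.1] at this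
        simp at this
    | succ e ih =>
      intro he β hβ ha
      rw [h1 (path D (e + 1) β) (by rw [length_path]; omega)]
      exact grundy_gate h hH (by omega) (ih (by omega)) hβ ha
  have := key (D + 1) le_rfl (fun _ => false) (fun _ _ => rfl) fun e h1 h2 => by omega
  rw [path_top] at this
  rw [← this]
  congr 1
  ext p
  simp only [Finset.mem_univ, mem_cyl, true_iff]
  intro i hi
  exact h.high p i (by omega)

end Value

end GateTree

/-! ### Unfolding a circuit along its paths -/

section Unfolding

variable {n : ℕ} (C : Circuit n) (g : Fin C.size)

theorem follow_append (π : List Bool) (b : Bool) :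
    C.follow g (π ++ [b]) = (C.follow g π).bind fun h => (C.gate h).preds[b.toNat]? := by
  induction π generalizing g with
  | nil =>
    simp only [List.nil_append, Circuit.follow, Option.bind_some]
    exact Option.bind_fun_some _
  | cons a π ih =>
    simp only [List.cons_append, Circuit.follow, Option.bind_assoc]
    exact Option.bind_congr fun h _ => ih h

/-- Each wire lowers the level; hence paths longer than the level of `g` lead nowhere and the
unfolding has bounded depth. -/
theorem level_follow {π : List Bool} {h : Fin C.size} (hf : C.follow g π = some h) :
    C.level h + π.length ≤ C.level g := by
  induction π generalizing g with
  | nil =>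
    simp only [Circuit.follow, Option.some.injEq] at hf
    simp [hf]
  | cons b π ih =>
    simp only [Circuit.follow, Option.bind_eq_some_iff] at hf
    obtain ⟨a, ha, hf⟩ := hf
    have h1 := ih a hf
    have h2 := C.level_lt g a (List.mem_of_getElem? ha)
    simp only [List.length_cons]
    omega

/-- The path `π` leads from `g` to a negation or a conjunction. -/
def NegatedAt (π : List Bool) : Prop :=
  ∃ h, C.follow g π = some h ∧ ((C.gate h).kind.1 = 1 ∨ (C.gate h).kind.1 = 2)

/-- The path `π` leads from `g` to the input with number `i`. -/
def InputAt (π : List Bool) (i : ℕ) : Prop :=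
  ∃ h, C.follow g π = some h ∧ (C.gate h).kind.1 = 0 ∧ (C.gate h).kind.2 = i

/-- The path `π` leads from `g` to a conjunction, and can be continued in the direction `b`. -/
def PredNegatedAt (π : List Bool) (b : Bool) : Prop :=
  ∃ h, C.follow g π = some h ∧ (C.gate h).kind.1 = 2 ∧ ∃ h', C.follow g (π ++ [b]) = some h'

/-- The path `π` leads from `g` to a negation, a conjunction, or an input with value `1`. -/
def ConstAt (x : Fin n → Bool) (π : List Bool) : Prop :=
  NegatedAt C g π ∨ ∃ i : Fin n, x i = true ∧ InputAt C g π i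

/-- The value of the gate to which a path leads. -/
def valueAt (x : Fin n → Bool) (π : List Bool) : Bool :=
  (C.follow g π).elim false (C.eval x)

theorem InputAt.unique {π : List Bool} {i j : ℕ} (hi : InputAt C g π i) (hj : InputAt C g π j) :
    i = j := by
  obtain ⟨h, h1, -, h2⟩ := hi
  obtain ⟨h', h1', -, h2'⟩ := hj
  rw [h1, Option.some.injEq] at h1'
  subst h1'
  rw [← h2, h2']

-- One recursion covers all gates. A conjunction negates its predecessors and its result; a negation
-- negates the disjunction of its only predecessor with false; an input has no predecessors and its
-- bit is the constant. A missing predecessor counts as false and must stay so, which is why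
-- `PredNegatedAt` asks for the predecessor to exist.
open scoped Classical in
theorem valueAt_eq (hC : ∀ g, ((C.gate g).preds).length ≤ 2) (x : Fin n → Bool) (π : List Bool) :
    valueAt C g x π =
      (((valueAt C g x (π ++ [false]) ^^ decide (PredNegatedAt C g π false)) ||
        (valueAt C g x (π ++ [true]) ^^ decide (PredNegatedAt C g π true))) ^^
          decide (ConstAt C g x π)) := by
  unfold valueAt PredNegatedAt ConstAt NegatedAt InputAt
  rcases hf : C.follow g π with _ | h
  · simp [follow_append, hf]
  · have hl := hC h
    simp only [follow_append, hf, Option.bind_some, Option.elim_some, Option.some.injEq,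
      exists_eq_left', Bool.toNat_false, Bool.toNat_true]
    rw [C.eval_eq x h]
    rcases hg : C.gate h with i | a | as | as
    · simp [Gate.preds, Gate.kind, Fin.val_inj]
    · simp [Gate.preds, Gate.kind]
    · rw [hg] at hl
      simp only [Gate.preds] at hl
      rcases as with _ | ⟨a, _ | ⟨b, _ | ⟨c, as⟩⟩⟩
      · simp [Gate.preds, Gate.kind]
      · simp [Gate.preds, Gate.kind]
      · simp [Gate.preds, Gate.kind]
      · simp at hl
    · rw [hg] at hl
      simp only [Gate.preds] at hl
      rcases as with _ | ⟨a, _ | ⟨b, _ | ⟨c, as⟩⟩⟩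
      · simp [Gate.preds, Gate.kind]
      · simp [Gate.preds, Gate.kind]
      · simp [Gate.preds, Gate.kind]
      · simp at hl

end Unfolding

/-! ### The poset of the reduction and the circuit that writes it -/

section ReductionOrder

/-- The order on the numbers below `m` that is given by the binary digits and a labelling. -/
abbrev treePartialOrder (m : ℕ) {S : ℕ → (ℕ → Bool) → Prop} (hS : IsLabelling S) :
    PartialOrder (Fin m) where
  le p q := p = q ∨ treeLt S (p : ℕ).testBit (q : ℕ).testBit
  lt p q := (p = q ∨ treeLt S (p : ℕ).testBit (q : ℕ).testBit) ∧
    ¬ (q = p ∨ treeLt S (q : ℕ).testBit (p : ℕ).testBit)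
  lt_iff_le_not_ge _ _ := Iff.rfl
  le_refl p := .inl rfl
  le_trans p q r := by
    rintro (rfl | h1) (rfl | h2)
    · exact .inl rfl
    · exact .inr h2
    · exact .inr h1
    · exact .inr (treeLt_trans hS h1 h2)
  le_antisymm p q := by
    rintro (rfl | h1) (h2 | h2)
    · rfl
    · rfl
    · exact h2.symm
    · exact absurd (treeLt_trans hS h1 h2) (treeLt_irrefl _)

theorem isTreeOrder_treePartialOrder (H : ℕ) {S : ℕ → (ℕ → Bool) → Prop} (hS : IsLabelling S) :
    @IsTreeOrder (Fin (2 ^ H)) (treePartialOrder _ hS) H S fun p => (p : ℕ).testBit :=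
  letI := treePartialOrder (2 ^ H) hS
  { labelling := hS
    injective := fun p q h => Fin.ext (Nat.eq_of_testBit_eq fun i => congrFun h i)
    high := fun p i hi =>
      Nat.testBit_lt_two_pow (p.2.trans_le (Nat.pow_le_pow_right (by norm_num) hi))
    surj := fun β hβ => by
      refine ⟨⟨Nat.ofBits fun i : Fin H => β i, Nat.ofBits_lt_two_pow _⟩, funext fun i => ?_⟩
      rcases lt_or_ge i H with hi | hi
      · exact Nat.testBit_ofBits_lt _ i hi
      · rw [hβ i hi]
        exact Nat.testBit_ofBits_ge _ i hi
    le_iff := fun p q => Iff.rfl }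

variable {n : ℕ} (D : ℕ) (C : Circuit n) (g : Fin C.size)

/-- The poset of the reduction. -/
abbrev reductionOrder (x : Fin n → Bool) : PartialOrder (Fin (2 ^ (8 * (D + 1) + 1))) :=
  treePartialOrder _ (isLabelling_gateLabel (D := D) (K := ConstAt C g x) (A := PredNegatedAt C g))

theorem nFree_reductionOrder (x : Fin n → Bool) : @NFree _ (reductionOrder D C g x) :=
  letI := reductionOrder D C g x
  (isTreeOrder_treePartialOrder _ isLabelling_gateLabel).nFree

theorem isExistsGame_reductionOrder (hC : ∀ g, ((C.gate g).preds).length ≤ 2)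
    (hD : C.level g ≤ D) (x : Fin n → Bool) :
    @IsExistsGame _ (reductionOrder D C g x) inferInstance ↔ C.eval x g = true := by
  let := reductionOrder D C g x
  have key := grundy_gateTree (isTreeOrder_treePartialOrder (8 * (D + 1) + 1)
    (isLabelling_gateLabel (D := D) (K := ConstAt C g x) (A := PredNegatedAt C g))) rfl
    (val := valueAt C g x) ?_ fun π _ => valueAt_eq C g hC x π
  · rw [IsExistsGame, wins_iff_grundy_ne_zero, key]
    have : valueAt C g x [] = C.eval x g := rfl
    rw [this]
    cases C.eval x g <;> simp
  · intro π hπ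
    rcases hf : C.follow g π with _ | h
    · simp [valueAt, hf]
    · have := level_follow C g hf
      omega

/-- The pairs that are related for every input. -/
def StaticLe (p q : ℕ) : Prop :=
  p = q ∨ treeLt (gateLabel D (NegatedAt C g) (PredNegatedAt C g)) p.testBit q.testBit

/-- The pairs that are related if and only if the input bit `i` is `1`. -/
def InputLe (p q i : ℕ) : Prop :=
  (∀ j, 0 < j → p.testBit j = q.testBit j) ∧ p.testBit 0 = false ∧ q.testBit 0 = true ∧
    OutConst D p.testBit fun π => InputAt C g π i

/-- The input occurs only in the second alternative of `ConstAt`, hence only in labels of nodes of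
height 1, where the two points differ in digit 0 alone. -/
theorem reductionOrder_le_iff (x : Fin n → Bool) (p q : Fin (2 ^ (8 * (D + 1) + 1))) :
    (reductionOrder D C g x).le p q ↔
      StaticLe D C g p q ∨ ∃ i : Fin n, x i = true ∧ InputLe D C g p q i := by
  change (p = q ∨ treeLt _ _ _) ↔ _
  unfold StaticLe
  rw [or_assoc, Fin.val_inj]
  refine or_congr_right ⟨?_, ?_⟩
  · rintro ⟨t, h1, h2, h3, h4 | ⟨rfl, ⟨e, he, ha, hz, h8, h4 | ⟨i, hi, h4⟩⟩ | h4⟩⟩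
    · exact .inl ⟨t, h1, h2, h3, .inl h4⟩
    · exact .inl ⟨0, h1, h2, h3, .inr ⟨rfl, .inl ⟨e, he, ha, hz, h8, h4⟩⟩⟩
    · exact .inr ⟨i, hi, h1, h2, h3, e, he, ha, hz, h8, h4⟩
    · exact .inl ⟨0, h1, h2, h3, .inr ⟨rfl, .inr h4⟩⟩
  · rintro (⟨t, h1, h2, h3, h4 | ⟨rfl, ⟨e, he, ha, hz, h8, h4⟩ | h4⟩⟩ |
      ⟨i, hi, h1, h2, h3, e, he, ha, hz, h8, h4⟩)
    · exact ⟨t, h1, h2, h3, .inl h4⟩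
    · exact ⟨0, h1, h2, h3, .inr ⟨rfl, .inl ⟨e, he, ha, hz, h8, .inl h4⟩⟩⟩
    · exact ⟨0, h1, h2, h3, .inr ⟨rfl, .inr h4⟩⟩
    · exact ⟨0, h1, h2, h3, .inr ⟨rfl, .inl ⟨e, he, ha, hz, h8, .inr ⟨i, hi, h4⟩⟩⟩⟩

/-- The block that ends the path is determined: its digit 8 is set, while all higher blocks are
`CopyBlock`s. So a matrix entry depends on at most one input bit. -/
theorem InputLe.unique {p q i j : ℕ} (hi : InputLe D C g p q i) (hj : InputLe D C g p q j) :
    i = j := by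
  obtain ⟨-, -, -, e, he, ha, -, h8, h⟩ := hi
  obtain ⟨-, -, -, e', he', ha', -, h8', h'⟩ := hj
  rcases lt_trichotomy e e' with hlt | rfl | hlt
  · have := (ha e' hlt he').1
    simp [h8'] at this
  · exact h.unique C g h'
  · have := (ha' e hlt he).1
    simp [h8] at this

open scoped Classical in
/-- The gate that computes the entry `(p, q)` of the adjacency matrix: an input or a constant. -/
noncomputable def entryGate (p q : ℕ) : Fin (n + 2) :=
  if StaticLe D C g p q then ⟨n, by omega⟩
  else if h : ∃ i : Fin n, InputLe D C g p q i then ⟨h.choose, by omega⟩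
  else ⟨n + 1, by omega⟩

/-- By uniqueness the choice in `entryGate` can be replaced by a first-order description. Gates `n`
and `n + 1` of `wireless` are the constants true and false. -/
theorem entryGate_eq_iff (p q k : ℕ) : k = entryGate D C g p q ↔
    StaticLe D C g p q ∧ k = n ∨ ¬ StaticLe D C g p q ∧
      ((k < n ∧ InputLe D C g p q k) ∨ (¬ ∃ i < n, InputLe D C g p q i) ∧ k = n + 1) := by
  unfold entryGate
  split_ifs with h1 h2
  · simp [h1]
  · have hs := h2.choose_spec
    have hn : ∃ i < n, InputLe D C g p q i := ⟨_, h2.choose.2, hs⟩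
    simp only [h1, false_and, not_false_eq_true, true_and, false_or, hn, not_true_eq_false,
      or_false]
    constructor
    · rintro rfl
      exact ⟨h2.choose.2, hs⟩
    · exact fun h => h.2.unique D C g hs
  · have hn : ¬ ∃ i < n, InputLe D C g p q i := fun ⟨i, hi, h⟩ => h2 ⟨⟨i, hi⟩, h⟩
    simp only [h1, false_and, not_false_eq_true, true_and, false_or, hn]
    constructor
    · exact fun h => .inr h
    · rintro (⟨hk, h⟩ | h)
      · exact absurd ⟨k, hk, h⟩ hn
      · exact h

/-- A circuit without wires whose gates are the inputs and the two constants. -/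
abbrev wireless (n : ℕ) (outs : List (Fin (n + 2))) : Circuit n where
  size := n + 2
  gate k := if h : (k : ℕ) < n then .input ⟨k, h⟩ else if (k : ℕ) = n then .and [] else .or []
  outs := outs
  level _ := 0
  level_lt k h hh := by
    split_ifs at hh <;> simp [Gate.preds] at hh

/-- The circuit that computes the adjacency matrix of the poset of the reduction. -/
noncomputable abbrev reductionCircuit : Circuit n :=
  wireless n (List.ofFn fun k : Fin (2 ^ (8 * (D + 1) + 1) * 2 ^ (8 * (D + 1) + 1)) =>
    entryGate D C g k.divNat k.modNat)

theorem eval_entryGate (outs : List (Fin (n + 2))) (x : Fin n → Bool)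
    (p q : Fin (2 ^ (8 * (D + 1) + 1))) :
    (wireless n outs).eval x (entryGate D C g p q) = true ↔ (reductionOrder D C g x).le p q := by
  rw [reductionOrder_le_iff, Circuit.eval_eq]
  unfold entryGate
  split_ifs with h1 h2
  · simp [wireless, h1]
  · have hs := h2.choose_spec
    simp only [wireless, h1, false_or]
    rw [dif_pos h2.choose.2]
    constructor
    · exact fun h => ⟨_, h, hs⟩
    · rintro ⟨i, hi, h⟩
      have : h2.choose = i := Fin.ext (hs.unique D C g h)
      simpa [this] using hi
  · have hn : ¬ ∃ i : Fin n, x i = true ∧ InputLe D C g p q i := fun ⟨i, _, h⟩ => h2 ⟨i, h⟩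
    simp [wireless, h1, hn]

theorem output_reductionCircuit (x : Fin n → Bool) :
    (reductionCircuit D C g).output x = encodeOrder (reductionOrder D C g x) := by
  classical
  unfold reductionCircuit Circuit.output encodeOrder
  change List.map _ (List.ofFn _) = _
  rw [List.map_ofFn]
  congr 1
  funext k
  rw [Bool.eq_iff_iff, decide_eq_true_iff]
  exact eval_entryGate D C g _ x _ _

end ReductionOrder

/-- Membership in `question` may be witnessed by any poset with the given encoding. The length `m *
m` determines `m`, and the entries determine the order. -/
theorem encodeOrder_injective {m m' : ℕ} {P : PartialOrder (Fin m)} {P' : PartialOrder (Fin m')}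
    (h : encodeOrder P = encodeOrder P') :
    @IsExistsGame (Fin m) P inferInstance ↔ @IsExistsGame (Fin m') P' inferInstance := by
  classical
  have hl := congrArg List.length h
  simp only [encodeOrder, List.length_ofFn] at hl
  obtain rfl : m = m' := by nlinarith
  have : P = P' := by
    refine PartialOrder.ext fun i j => ?_
    have hk := congrFun (List.ofFn_injective h) (finProdFinEquiv (i, j))
    have h2 := finProdFinEquiv.symm_apply_apply (i, j)
    simp only [finProdFinEquiv_symm_apply, Prod.mk.injEq] at h2
    rw [decide_eq_decide, h2.1, h2.2] at hk
    exact hk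
  rw [this]

/-! ### A calculus of definable relations and functions -/

section Definability

open FirstOrder Language

variable {α β γ : Type}

/-- The universe `{0, …, N - 1}` contains the `c`-th power of a number `b` that exceeds all
components of `v`. -/
def Fits {N : ℕ} (b c : ℕ) (v : α → Fin N) : Prop :=
  2 ≤ b ∧ (∀ i, (v i : ℕ) + 2 ≤ b) ∧ b ^ c ≤ N

theorem Fits.mono {N b c c' : ℕ} {v : α → Fin N} (h : Fits b c v) (hc : c' ≤ c) : Fits b c' v :=
  ⟨h.1, h.2.1, (Nat.pow_le_pow_right (by have := h.1; omega) hc).trans h.2.2⟩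

/-- One formula defines `R v y` in all universes that are polynomially larger than `v`. -/
def DefIn (R : (α → ℕ) → (γ → ℕ) → Prop) : Prop :=
  ∃ (c : ℕ) (φ : numLanguage.Formula (α ⊕ γ)), ∀ (N b : ℕ) (v : α → Fin N) (y : γ → Fin N),
    Fits b c v → (R (fun i => v i) (fun i => y i) ↔ φ.Realize (Sum.elim v y))

/-- One formula defines `R` in all universes that are polynomially larger than the arguments. -/
def Def (R : (α → ℕ) → Prop) : Prop :=
  DefIn (γ := Empty) fun v _ => R v

/-- A function of polynomial growth with a definable graph. -/
structure PolyFun (f : (α → ℕ) → ℕ) : Prop where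
  growth : ∃ d, ∀ v b, 2 ≤ b → (∀ i, v i + 2 ≤ b) → f v + 2 ≤ b ^ d
  graph : DefIn (γ := Unit) fun v y => y () = f v

theorem DefIn.not {R : (α → ℕ) → (γ → ℕ) → Prop} (h : DefIn R) : DefIn fun v y => ¬ R v y := by
  obtain ⟨c, φ, h⟩ := h
  refine ⟨c, φ.not, fun N b v y hv => ?_⟩
  exact not_congr (h N b v y hv)

theorem DefIn.and {R R' : (α → ℕ) → (γ → ℕ) → Prop} (h : DefIn R) (h' : DefIn R') :
    DefIn fun v y => R v y ∧ R' v y := by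
  obtain ⟨c, φ, h⟩ := h
  obtain ⟨c', φ', h'⟩ := h'
  refine ⟨max c c', φ ⊓ φ', fun N b v y hv => ?_⟩
  rw [Formula.realize_inf]
  exact and_congr (h N b v y (hv.mono (le_max_left _ _))) (h' N b v y (hv.mono (le_max_right _ _)))

theorem DefIn.congr {R R' : (α → ℕ) → (γ → ℕ) → Prop} (h : DefIn R)
    (e : ∀ v y, R' v y ↔ R v y) : DefIn R' := by
  obtain ⟨c, φ, h⟩ := h
  exact ⟨c, φ, fun N b v y hv => (e _ _).trans (h N b v y hv)⟩

/-- The formula guesses the values `f i v` and checks them by their graphs. The arguments `y` in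
`DefIn` may be any elements of the universe, not only small ones, so the graph formulas reject every
wrong guess. -/
theorem DefIn.comp [Finite β] {R : (β → ℕ) → (γ → ℕ) → Prop} (h : DefIn R)
    {f : β → (α → ℕ) → ℕ} (hf : ∀ i, PolyFun (f i)) :
    DefIn fun v y => R (fun i => f i v) y := by
  obtain ⟨c, φ, h⟩ := h
  choose d hd using fun i => (hf i).growth
  choose e ψ hψ using fun i => (hf i).graph
  cases nonempty_fintype β
  set d' := ∑ i, d i + 1 with hd'
  -- The sum serves the graph formulas. The other summand makes room for the values themselves and
  -- for the `c`-th power of the new base `b ^ d'`.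
  refine ⟨∑ i, e i + d' * (c + 1), Formula.iExs β ((Formula.iInf fun i =>
    (ψ i).relabel (Sum.elim (Sum.inl ∘ Sum.inl) fun _ => Sum.inr i)) ⊓
      φ.relabel (Sum.elim Sum.inr (Sum.inl ∘ Sum.inr))), fun N b v y hv => ?_⟩
  have hb := hv.1
  have hle (i : β) : f i (fun j => v j) + 2 ≤ b ^ d' :=
    (hd i _ b hb hv.2.1).trans (Nat.pow_le_pow_right (by omega)
      ((Finset.single_le_sum (fun _ _ => Nat.zero_le _) (Finset.mem_univ i)).trans
        (Nat.le_succ _)))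
  have hN : b ^ (d' * (c + 1)) ≤ N :=
    (Nat.pow_le_pow_right (by omega) (Nat.le_add_left _ _)).trans hv.2.2
  have hlt (i : β) : f i (fun j => v j) < N := by
    have : b ^ d' ≤ b ^ (d' * (c + 1)) := Nat.pow_le_pow_right (by omega) (by nlinarith)
    have := hle i
    omega
  have hfits : Fits (b ^ d') c fun i => (⟨f i fun j => v j, hlt i⟩ : Fin N) := by
    refine ⟨?_, hle, ?_⟩
    · calc 2 ≤ b ^ 1 := by simpa using hb
        _ ≤ b ^ d' := Nat.pow_le_pow_right (by omega) (by omega)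
    · rw [← pow_mul]
      exact (Nat.pow_le_pow_right (by omega) (by nlinarith)).trans hN
  have hg (i : β) (z : β → Fin N) : (z i : ℕ) = f i (fun j => v j) ↔
      (ψ i).Realize (Sum.elim v fun _ : Unit => z i) :=
    hψ i N b v (fun _ => z i) (hv.mono ((Finset.single_le_sum (fun _ _ => Nat.zero_le _)
      (Finset.mem_univ i)).trans (Nat.le_add_right _ _)))
  simp only [Formula.realize_iExs, Formula.realize_inf, Formula.realize_iInf,
    Formula.realize_relabel, Sum.comp_elim]
  have e1 (z : β → Fin N) (i : β) : ((Sum.elim (Sum.elim v y) z ∘ Sum.elim (Sum.inl ∘ Sum.inl)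
      fun _ : Unit => Sum.inr i) : α ⊕ Unit → Fin N) = Sum.elim v fun _ => z i := by
    ext o
    rcases o with o | o <;> rfl
  have e2 (z : β → Fin N) : ((Sum.elim (Sum.elim v y) z ∘
      Sum.elim Sum.inr (Sum.inl ∘ Sum.inr)) : β ⊕ γ → Fin N) = Sum.elim z y := by
    ext o
    rcases o with o | o <;> rfl
  simp only [← Sum.comp_elim, e1, e2]
  constructor
  · intro hR
    refine ⟨fun i => ⟨f i fun j => v j, hlt i⟩,
      fun i => (hg i fun i => ⟨f i fun j => v j, hlt i⟩).1 rfl, ?_⟩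
    exact (h N _ _ y hfits).1 hR
  · rintro ⟨z, hz, hφ⟩
    obtain rfl : z = fun i => ⟨f i fun j => v j, hlt i⟩ :=
      funext fun i => Fin.ext ((hg i z).2 (hz i))
    exact (h N _ _ y hfits).2 hφ

theorem Def.comp [Finite β] {R : (β → ℕ) → Prop} (h : Def R) {f : β → (α → ℕ) → ℕ}
    (hf : ∀ i, PolyFun (f i)) : Def fun v => R fun i => f i v :=
  DefIn.comp h hf

theorem PolyFun.comp [Finite β] {g : (β → ℕ) → ℕ} (h : PolyFun g) {f : β → (α → ℕ) → ℕ}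
    (hf : ∀ i, PolyFun (f i)) : PolyFun fun v => g fun i => f i v := by
  refine ⟨?_, DefIn.comp h.graph hf⟩
  obtain ⟨c, h⟩ := h.growth
  choose d hd using fun i => (hf i).growth
  cases nonempty_fintype β
  refine ⟨(∑ i, d i + 1) * c, fun v b hb hv => ?_⟩
  rw [pow_mul]
  refine h _ _ ?_ fun i => ?_
  · calc 2 ≤ b ^ 1 := by simpa using hb
      _ ≤ _ := Nat.pow_le_pow_right (by omega) (by omega)
  · exact (hd i v b hb hv).trans (Nat.pow_le_pow_right (by omega)
      ((Finset.single_le_sum (fun _ _ => Nat.zero_le _) (Finset.mem_univ i)).trans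
        (Nat.le_succ _)))

/-- A numerical predicate as a formula in variables. -/
def atom {k : ℕ} (r : NumRel k) (t : Fin k → α) : numLanguage.Formula α :=
  Relations.formula (L := numLanguage) r fun i => Term.var (t i)

theorem realize_atom {k N : ℕ} (r : NumRel k) (t : Fin k → α) (v : α → Fin N) :
    (atom r t).Realize v ↔ Structure.RelMap (L := numLanguage) r fun i => v (t i) :=
  Formula.realize_rel

theorem realize_le {N : ℕ} (a b : α) (v : α → Fin N) :
    (atom .le ![a, b]).Realize v ↔ (v a : ℕ) ≤ v b := realize_atom _ _ _

theorem realize_add {N : ℕ} (a b c : α) (v : α → Fin N) :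
    (atom .add ![a, b, c]).Realize v ↔ (v a : ℕ) + v b = v c := realize_atom _ _ _

theorem realize_mul {N : ℕ} (a b c : α) (v : α → Fin N) :
    (atom .mul ![a, b, c]).Realize v ↔ (v a : ℕ) * v b = v c := realize_atom _ _ _

theorem realize_bit {N : ℕ} (a b : α) (v : α → Fin N) :
    (atom .bit ![a, b]).Realize v ↔ (v a : ℕ).testBit (v b) = true := realize_atom _ _ _

theorem PolyFun.var (a : α) : PolyFun fun v : α → ℕ => v a where
  growth := ⟨1, fun v b _ hv => by simpa using hv a⟩
  graph := by
    refine ⟨0, atom .le ![Sum.inl a, Sum.inr ()] ⊓ atom .le ![Sum.inr (), Sum.inl a],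
      fun N b v y _ => ?_⟩
    rw [Formula.realize_inf, realize_le, realize_le]
    simp only [Sum.elim_inl, Sum.elim_inr]
    omega

theorem Fits.pair {b : ℕ} {v : Fin 2 → ℕ} (hv : ∀ i, v i + 2 ≤ b) :
    v 0 + v 1 + 2 ≤ b ^ 2 ∧ v 0 * v 1 + 2 ≤ b ^ 2 := by
  have h0 := hv 0
  have h1 := hv 1
  constructor <;> nlinarith

theorem PolyFun.add {f g : (α → ℕ) → ℕ} (hf : PolyFun f) (hg : PolyFun g) :
    PolyFun fun v => f v + g v := by
  have h : PolyFun fun v : Fin 2 → ℕ => v 0 + v 1 :=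
    { growth := ⟨2, fun v b _ hv => (Fits.pair hv).1⟩
      graph := ⟨0, atom .add ![Sum.inl 0, Sum.inl 1, Sum.inr ()], fun N b v y _ => by
        rw [realize_add, eq_comm]; rfl⟩ }
  exact h.comp (f := ![f, g]) (by simp [Fin.forall_fin_two, hf, hg])

theorem PolyFun.mul {f g : (α → ℕ) → ℕ} (hf : PolyFun f) (hg : PolyFun g) :
    PolyFun fun v => f v * g v := by
  have h : PolyFun fun v : Fin 2 → ℕ => v 0 * v 1 :=
    { growth := ⟨2, fun v b _ hv => (Fits.pair hv).2⟩
      graph := ⟨0, atom .mul ![Sum.inl 0, Sum.inl 1, Sum.inr ()], fun N b v y _ => by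
        rw [realize_mul, eq_comm]; rfl⟩ }
  exact h.comp (f := ![f, g]) (by simp [Fin.forall_fin_two, hf, hg])

/-- The number 0 is the solution of `y + y = y`, and 1 is the other solution of `y * y = y`; the
rest follows by addition. -/
theorem PolyFun.const (k : ℕ) : PolyFun fun _ : α → ℕ => k := by
  induction k with
  | zero =>
    refine ⟨⟨1, fun v b hb _ => by simpa using hb⟩, 0,
      atom .add ![Sum.inr (), Sum.inr (), Sum.inr ()], fun N b v y _ => ?_⟩
    rw [realize_add]
    simp
  | succ k ih =>
    refine ih.add (g := fun _ => 1) ⟨⟨2, fun v b hb _ => by nlinarith⟩, 0,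
      atom .mul ![Sum.inr (), Sum.inr (), Sum.inr ()] ⊓
        (atom .add ![Sum.inr (), Sum.inr (), Sum.inr ()]).not, fun N b v y _ => ?_⟩
    rw [Formula.realize_inf, Formula.realize_not, realize_add, realize_mul]
    simp only [Sum.elim_inr]
    constructor
    · intro h
      simp [h]
    · rintro ⟨h1, h2⟩
      have : 0 < (y () : ℕ) := by omega
      exact Nat.eq_of_mul_eq_mul_left this (by omega)

theorem PolyFun.pow {f : (α → ℕ) → ℕ} (hf : PolyFun f) (k : ℕ) : PolyFun fun v => f v ^ k := by
  induction k with
  | zero => simpa using PolyFun.const 1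
  | succ k ih => simpa [pow_succ] using ih.mul hf

theorem Def.not {R : (α → ℕ) → Prop} (h : Def R) : Def fun v => ¬ R v := DefIn.not h

theorem Def.and {R R' : (α → ℕ) → Prop} (h : Def R) (h' : Def R') : Def fun v => R v ∧ R' v :=
  DefIn.and h h'

theorem Def.congr {R R' : (α → ℕ) → Prop} (h : Def R) (e : ∀ v, R' v ↔ R v) : Def R' :=
  DefIn.congr h fun v _ => e v

theorem Def.or {R R' : (α → ℕ) → Prop} (h : Def R) (h' : Def R') : Def fun v => R v ∨ R' v :=
  (h.not.and h'.not).not.congr fun v => by tauto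

theorem Def.imp {R R' : (α → ℕ) → Prop} (h : Def R) (h' : Def R') : Def fun v => R v → R' v :=
  (h.not.or h').congr fun v => by tauto

theorem Def.iff {R R' : (α → ℕ) → Prop} (h : Def R) (h' : Def R') : Def fun v => (R v ↔ R' v) :=
  ((h.imp h').and (h'.imp h)).congr fun v => by tauto

theorem Def.le {f g : (α → ℕ) → ℕ} (hf : PolyFun f) (hg : PolyFun g) :
    Def fun v => f v ≤ g v := by
  have h : Def fun v : Fin 2 → ℕ => v 0 ≤ v 1 :=
    ⟨0, atom .le ![Sum.inl 0, Sum.inl 1], fun N b v y _ => by rw [realize_le]; rfl⟩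
  exact h.comp (f := ![f, g]) (by simp [Fin.forall_fin_two, hf, hg])

theorem Def.lt {f g : (α → ℕ) → ℕ} (hf : PolyFun f) (hg : PolyFun g) :
    Def fun v => f v < g v :=
  (Def.le hg hf).not.congr fun v => by omega

theorem Def.eq {f g : (α → ℕ) → ℕ} (hf : PolyFun f) (hg : PolyFun g) :
    Def fun v => f v = g v :=
  ((Def.le hf hg).and (Def.le hg hf)).congr fun v => by omega

theorem Def.testBit {f g : (α → ℕ) → ℕ} (hf : PolyFun f) (hg : PolyFun g) :
    Def fun v => (f v).testBit (g v) = true := by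
  have h : Def fun v : Fin 2 → ℕ => (v 0).testBit (v 1) = true :=
    ⟨0, atom .bit ![Sum.inl 0, Sum.inl 1], fun N b v y _ => by rw [realize_bit]; rfl⟩
  exact h.comp (f := ![f, g]) (by simp [Fin.forall_fin_two, hf, hg])

theorem Def.testBit_false {f g : (α → ℕ) → ℕ} (hf : PolyFun f) (hg : PolyFun g) :
    Def fun v => (f v).testBit (g v) = false :=
  (Def.testBit hf hg).not.congr fun v => by simp

/-- Bounded existential quantification. -/
theorem Def.ex {g : (α → ℕ) → ℕ} (hg : PolyFun g) {P : (α → ℕ) → ℕ → Prop}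
    (hP : Def fun w : Option α → ℕ => P (fun i => w (some i)) (w none)) :
    Def fun v => ∃ x ≤ g v, P v x := by
  obtain ⟨d, hd⟩ := hg.growth
  obtain ⟨e, ψ, hψ⟩ := hg.graph
  obtain ⟨c, φ, hφ⟩ := hP
  -- The variable `true` holds the bound `g v`, the variable `false` the witness.
  refine ⟨e + (d + 1) * (c + 1), Formula.iExs Bool
    ((ψ.relabel (Sum.elim (fun a => Sum.inl (Sum.inl a)) fun _ => Sum.inr true)) ⊓
      atom .le ![Sum.inr false, Sum.inr true] ⊓
        φ.relabel (Sum.elim (fun o => o.elim (Sum.inr false) fun a => Sum.inl (Sum.inl a))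
          Empty.elim)), fun N b v y hv => ?_⟩
  have hb := hv.1
  have hle : g (fun j => v j) + 2 ≤ b ^ (d + 1) :=
    (hd _ b hb hv.2.1).trans (Nat.pow_le_pow_right (by omega) (by omega))
  have hb' : b ≤ b ^ (d + 1) := Nat.le_self_pow (by omega) b
  have hN : b ^ ((d + 1) * (c + 1)) ≤ N :=
    (Nat.pow_le_pow_right (by omega) (Nat.le_add_left _ _)).trans hv.2.2
  have hlt : g (fun j => v j) < N := by
    have : b ^ (d + 1) ≤ b ^ ((d + 1) * (c + 1)) :=
      Nat.pow_le_pow_right (by omega) (by nlinarith)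
    omega
  have hgr (z : Fin N) : (z : ℕ) = g (fun j => v j) ↔
      ψ.Realize (Sum.elim v fun _ : Unit => z) :=
    hψ N b v (fun _ => z) (hv.mono (by omega))
  have hex (x : Fin N) (hx : (x : ℕ) ≤ g fun j => v j) :=
    hφ N (b ^ (d + 1)) (fun o => o.elim x v) y ⟨hb.trans hb', fun o => by
      rcases o with _ | a
      · simp only [Option.elim_none]
        omega
      · have := hv.2.1 a
        simp only [Option.elim_some]
        omega, by
      rw [← pow_mul]
      exact (Nat.pow_le_pow_right (by omega) (by nlinarith)).trans hN⟩
  have e1 (z : Bool → Fin N) : ((Sum.elim (Sum.elim v y) z ∘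
      Sum.elim (fun a => Sum.inl (Sum.inl a)) fun _ : Unit => Sum.inr true) :
        α ⊕ Unit → Fin N) = Sum.elim v fun _ => z true := by
    ext o
    rcases o with o | o <;> rfl
  have e2 (z : Bool → Fin N) : ((Sum.elim (Sum.elim v y) z ∘
      Sum.elim (fun o => o.elim (Sum.inr false) fun a => Sum.inl (Sum.inl a)) Empty.elim) :
        Option α ⊕ Empty → Fin N) = Sum.elim (fun o => o.elim (z false) v) y := by
    ext o
    rcases o with (_ | o) | o
    · rfl
    · rfl
    · exact o.elim
  simp only [Formula.realize_iExs, Formula.realize_inf, Formula.realize_relabel, realize_le, e1, e2]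
  constructor
  · rintro ⟨x, hx, hP⟩
    refine ⟨fun o => if o then ⟨_, hlt⟩ else ⟨x, hx.trans_lt hlt⟩,
      ⟨(hgr _).1 rfl, by simpa using hx⟩, ?_⟩
    exact (hex ⟨x, hx.trans_lt hlt⟩ hx).1 hP
  · rintro ⟨z, ⟨h1, h2⟩, h3⟩
    have hz := (hgr _).2 h1
    have hx : (z false : ℕ) ≤ g fun j => v j := by
      simp only [Sum.elim_inr] at h2
      omega
    exact ⟨z false, hx, (hex _ hx).2 h3⟩

/-- Bounded universal quantification. -/
theorem Def.all {g : (α → ℕ) → ℕ} (hg : PolyFun g) {P : (α → ℕ) → ℕ → Prop}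
    (hP : Def fun w : Option α → ℕ => P (fun i => w (some i)) (w none)) :
    Def fun v => ∀ x ≤ g v, P v x :=
  (Def.ex (P := fun v x => ¬ P v x) hg hP.not).not.congr fun v => by simp

/-- A graph formula must decide every `y` of the universe, but `hf` is reliable only for small
arguments. Testing `y ≤ g v` first confines `y` to that range. -/
theorem PolyFun.of_le {f g : (α → ℕ) → ℕ} (hg : PolyFun g) (hfg : ∀ v, f v ≤ g v)
    (hf : Def fun w : Option α → ℕ => w none = f fun i => w (some i)) : PolyFun f := by
  obtain ⟨d, hd⟩ := hg.growth
  refine ⟨⟨d, fun v b hb hv => (Nat.add_le_add_right (hfg v) 2).trans (hd v b hb hv)⟩, ?_⟩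
  obtain ⟨e, ψ, hψ⟩ := hg.graph
  obtain ⟨c, φ, hφ⟩ := hf
  refine ⟨e + (d + 1) * (c + 1), Formula.iExs Unit
    ((ψ.relabel (Sum.elim (fun a => Sum.inl (Sum.inl a)) Sum.inr)) ⊓
      atom .le ![Sum.inl (Sum.inr ()), Sum.inr ()] ⊓
        φ.relabel (Sum.elim
          (fun o => o.elim (Sum.inl (Sum.inr ())) fun a => Sum.inl (Sum.inl a))
          Empty.elim)), fun N b v y hv => ?_⟩
  have hb := hv.1
  have hle : g (fun j => v j) + 2 ≤ b ^ (d + 1) :=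
    (hd _ b hb hv.2.1).trans (Nat.pow_le_pow_right (by omega) (by omega))
  have hb' : b ≤ b ^ (d + 1) := Nat.le_self_pow (by omega) b
  have hN : b ^ ((d + 1) * (c + 1)) ≤ N :=
    (Nat.pow_le_pow_right (by omega) (Nat.le_add_left _ _)).trans hv.2.2
  have hlt : g (fun j => v j) < N := by
    have : b ^ (d + 1) ≤ b ^ ((d + 1) * (c + 1)) :=
      Nat.pow_le_pow_right (by omega) (by nlinarith)
    omega
  have hgr (z : Unit → Fin N) : (z () : ℕ) = g (fun j => v j) ↔ ψ.Realize (Sum.elim v z) :=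
    hψ N b v z (hv.mono (by omega))
  have hex (hx : (y () : ℕ) ≤ g fun j => v j) :=
    hφ N (b ^ (d + 1)) (fun o => o.elim (y ()) v) Empty.elim ⟨hb.trans hb', fun o => by
      rcases o with _ | a
      · simp only [Option.elim_none]
        omega
      · have := hv.2.1 a
        simp only [Option.elim_some]
        omega, by
      rw [← pow_mul]
      exact (Nat.pow_le_pow_right (by omega) (by nlinarith)).trans hN⟩
  have e1 (z : Unit → Fin N) : ((Sum.elim (Sum.elim v y) z ∘
      Sum.elim (fun a => Sum.inl (Sum.inl a)) Sum.inr) :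
        α ⊕ Unit → Fin N) = Sum.elim v z := by
    ext o
    rcases o with o | o <;> rfl
  have e2 (z : Unit → Fin N) : ((Sum.elim (Sum.elim v y) z ∘
      Sum.elim (fun o => o.elim (Sum.inl (Sum.inr ())) fun a => Sum.inl (Sum.inl a))
        Empty.elim) : Option α ⊕ Empty → Fin N) =
          Sum.elim (fun o => o.elim (y ()) v) Empty.elim := by
    ext o
    rcases o with (_ | o) | o
    · rfl
    · rfl
    · exact o.elim
  simp only [Formula.realize_iExs, Formula.realize_inf, Formula.realize_relabel, realize_le, e1, e2]
  constructor
  · intro hy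
    have hx : (y () : ℕ) ≤ g fun j => v j := hy.trans_le (hfg _)
    exact ⟨fun _ => ⟨_, hlt⟩, ⟨(hgr _).1 rfl, hx⟩, (hex hx).1 hy⟩
  · rintro ⟨z, ⟨h1, h2⟩, h3⟩
    have hz := (hgr _).2 h1
    have hx : (y () : ℕ) ≤ g fun j => v j := by
      simp only [Sum.elim_inr, Sum.elim_inl] at h2
      omega
    exact (hex hx).2 h3

end Definability

/-! ### Changing the universe; comparison with `FODefinable` -/

section Relativization

open FirstOrder Language

variable {α : Type}

/-- All quantifiers are bounded by a new variable. -/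
def relativize : ∀ {n : ℕ}, numLanguage.BoundedFormula α n → numLanguage.BoundedFormula (Option α) n
  | _, .falsum => .falsum
  | _, .equal t t' => .equal (t.relabel (Sum.map some id)) (t'.relabel (Sum.map some id))
  | _, .rel r t => .rel r fun i => (t i).relabel (Sum.map some id)
  | _, .imp φ ψ => .imp (relativize φ) (relativize ψ)
  | n, .all φ => .all (.imp (BoundedFormula.not (.rel (L := numLanguage) (l := 2) NumRel.le
      ![Term.var (Sum.inl none), Term.var (Sum.inr (Fin.last n))])) (relativize φ))

theorem realize_term_castLE {M N : ℕ} (h : M ≤ N) (t : numLanguage.Term α) (u : α → Fin M) :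
    t.realize (fun a => Fin.castLE h (u a)) = Fin.castLE h (t.realize u) := by
  cases t with
  | var a => rfl
  | func f _ => exact Empty.elim f

/-- The language is relational and its predicates do not depend on the universe, so only quantifiers
notice that it grows. -/
theorem realize_relativize {n N : ℕ} (φ : numLanguage.BoundedFormula α n) (M : Fin N)
    (u : α → Fin M) (xs : Fin n → Fin M) :
    (relativize φ).Realize (fun o => o.elim M fun a => Fin.castLE M.2.le (u a))
      (fun i => Fin.castLE M.2.le (xs i)) ↔ φ.Realize u xs := by
  have ht {n : ℕ} (xs : Fin n → Fin M) (t : numLanguage.Term (α ⊕ Fin n)) :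
      (t.relabel (Sum.map some id)).realize (Sum.elim (fun o : Option α =>
        o.elim M fun a => Fin.castLE M.2.le (u a)) fun i => Fin.castLE M.2.le (xs i)) =
      Fin.castLE M.2.le (t.realize (Sum.elim u xs)) := by
    rw [Term.realize_relabel, ← realize_term_castLE]
    congr 1
    ext o
    rcases o with o | o <;> rfl
  induction φ with
  | falsum => rfl
  | equal t t' =>
    simp only [relativize, BoundedFormula.Realize, ht]
    exact Fin.castLE_inj
  | rel r t =>
    simp only [relativize, BoundedFormula.Realize, ht]
    cases r <;> rfl
  | imp φ ψ ih ih' =>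
    simp only [relativize, BoundedFormula.Realize, ih, ih']
  | all φ ih =>
    simp only [relativize, BoundedFormula.Realize]
    have hs (x : Fin M) : Fin.snoc (fun i => Fin.castLE M.2.le (xs i)) (Fin.castLE M.2.le x) =
        fun i => Fin.castLE M.2.le ((Fin.snoc xs x : Fin (_ + 1) → Fin M) i) := by
      ext i
      refine Fin.lastCases ?_ (fun i => ?_) i <;> simp
    have hlt (x : Fin N) : (BoundedFormula.not (.rel (L := numLanguage) (l := 2) NumRel.le
        ![Term.var (Sum.inl none), Term.var (Sum.inr (Fin.last _))])).Realize
          (fun o : Option α => o.elim M fun a => Fin.castLE M.2.le (u a))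
          (Fin.snoc (fun i => Fin.castLE M.2.le (xs i)) x : Fin (_ + 1) → Fin N) ↔
        (x : ℕ) < M := by
      rw [BoundedFormula.realize_not, ← not_le]
      refine not_congr ?_
      change ((M : ℕ) ≤ (Fin.snoc (fun i => Fin.castLE M.2.le (xs i)) x : Fin (_ + 1) → Fin N)
        (Fin.last _)) ↔ _
      rw [Fin.snoc_last]
    constructor
    · intro h x
      have := h (Fin.castLE M.2.le x) ((hlt _).2 x.2)
      rw [hs] at this
      exact (ih _).1 this
    · intro h x hx
      have := (ih _).2 (h ⟨x, (hlt x).1 hx⟩)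
      rw [← hs] at this
      exact this

theorem PolyFun.up [Finite α] {f : (α → ℕ) → ℕ} (hf : PolyFun f) :
    PolyFun fun w : Option α → ℕ => f fun i => w (some i) :=
  hf.comp (f := fun i w => w (some i)) fun i => PolyFun.var (some i)

/-- The size of the original universe becomes an extra variable to which the formula is relativized;
then the polynomial `(n + 2) ^ (c + 1)` is substituted for it. -/
theorem FODefinable.def {k : ℕ} {R : ℕ → (Fin k → ℕ) → Prop} (h : FODefinable R) :
    Def fun v : Fin (k + 1) → ℕ => R (v 0) fun i => v i.succ := by
  obtain ⟨c, φ, h⟩ := h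
  have h1 : Def fun w : Option (Fin (k + 1)) → ℕ => ∃ u : Fin (k + 1) → Fin (w none),
      (∀ i, (u i : ℕ) = w (some i)) ∧ φ.Realize u := by
    refine ⟨0, (Formula.iInf fun i => (atom .le ![Sum.inl none, Sum.inl (some i)]).not) ⊓
      Formula.relabel Sum.inl (relativize φ), fun N b v y _ => ?_⟩
    simp only [Formula.realize_inf, Formula.realize_iInf, Formula.realize_not, realize_le,
      Sum.elim_inl, not_le, Formula.realize_relabel]
    have key (u : Fin (k + 1) → Fin (v none)) (hu : ∀ i, (u i : ℕ) = v (some i)) :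
        Formula.Realize (M := Fin N) (relativize φ) (Sum.elim v y ∘ Sum.inl) ↔ φ.Realize u := by
      have := realize_relativize φ (v none) u Fin.elim0
      refine Iff.trans ?_ (this.trans (iff_of_eq (congrArg _ (Subsingleton.elim _ _))))
      rw [Formula.Realize]
      refine iff_of_eq (congrArg₂ _ ?_ (Subsingleton.elim _ _))
      ext o
      rcases o with _ | i
      · rfl
      · exact (hu i).symm
    constructor
    · rintro ⟨u, hu, hφ⟩
      exact ⟨fun i => (hu i) ▸ (u i).2, (key u hu).2 hφ⟩
    · rintro ⟨hlt, hφ⟩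
      exact ⟨fun i => ⟨v (some i), hlt i⟩, fun _ => rfl, (key _ fun _ => rfl).1 hφ⟩
  refine (h1.comp (f := fun o v => o.elim ((v 0 + 2) ^ (c + 1)) v) ?_).congr fun v => ?_
  · rintro (_ | i)
    · exact ((PolyFun.var 0).add (PolyFun.const 2)).pow _
    · exact PolyFun.var i
  · rw [h]
    simp only [Option.elim_none, Option.elim_some, Fin.forall_fin_succ (n := k), and_assoc]
    exact Iff.rfl

/-- The formula of a `Def` may be wrong on large arguments, so the new formula also tests `v i ≤ (n
+ 2) ^ d`, which by `hb` excludes nothing. -/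
theorem Def.foDefinable {k : ℕ} {R : ℕ → (Fin k → ℕ) → Prop}
    (h : Def fun v : Fin (k + 1) → ℕ => R (v 0) fun i => v i.succ)
    (hb : ∃ d, ∀ n v, R n v → ∀ i, v i ≤ (n + 2) ^ d) : FODefinable R := by
  obtain ⟨d, hb⟩ := hb
  obtain ⟨c, φ, hφ⟩ := h
  obtain ⟨e, ψ, hψ⟩ := (((PolyFun.var (0 : Fin 1)).add (PolyFun.const 2)).pow d).graph
  -- The base `(n + 2) ^ (d + 2)` exceeds all tested arguments by two, and `φ` needs its `c`-th
  -- power; `ψ` needs the `e`-th power of `n + 2`; the bound `(n + 2) ^ d` must itself lie in the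
  -- universe.
  refine ⟨(d + 2) * c + d + e, φ.relabel (Sum.elim id Empty.elim) ⊓ Formula.iExs Unit
    (ψ.relabel (Sum.map (fun _ => 0) id) ⊓
      Formula.iInf fun i : Fin k => atom .le ![Sum.inl i.succ, Sum.inr ()]), fun n v => ?_⟩
  set N := (n + 2) ^ ((d + 2) * c + d + e + 1) with hN
  have hn2 : n + 2 ≤ (n + 2) ^ (d + 2) := Nat.le_self_pow (by omega) _
  have hd2 : (n + 2) ^ d + 2 ≤ (n + 2) ^ (d + 2) := by
    have : 1 ≤ (n + 2) ^ d := Nat.one_le_pow _ _ (by omega)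
    have : 4 ≤ (n + 2) ^ 2 := by nlinarith
    rw [pow_add]
    nlinarith
  have hpow {a : ℕ} (ha : a ≤ (d + 2) * c + d + e + 1) : (n + 2) ^ a ≤ N :=
    Nat.pow_le_pow_right (by omega) ha
  have hdN : (n + 2) ^ d < N := Nat.pow_lt_pow_right (by omega) (by nlinarith)
  have key (u : Fin (k + 1) → Fin N) (h0 : (u 0 : ℕ) = n) (hv : ∀ i : Fin k, (u i.succ : ℕ) = v i) :
      (φ.relabel (Sum.elim id Empty.elim) ⊓ Formula.iExs Unit
        (ψ.relabel (Sum.map (fun _ => 0) id) ⊓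
          Formula.iInf fun i : Fin k => atom .le ![Sum.inl i.succ, Sum.inr ()])).Realize u ↔
        R n v ∧ ∀ i, v i ≤ (n + 2) ^ d := by
    have e1 : u ∘ Sum.elim id Empty.elim = Sum.elim u (Empty.elim : Empty → Fin N) := by
      ext o
      rcases o with o | o
      · rfl
      · exact o.elim
    have e2 (z : Unit → Fin N) : ((Sum.elim u z ∘ Sum.map (fun _ => 0) id) : Fin 1 ⊕ Unit → Fin N) =
        Sum.elim (fun _ => u 0) z := by
      ext o
      rcases o with o | o <;> rfl
    have hz (z : Unit → Fin N) : (z () : ℕ) = (n + 2) ^ d ↔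
        ψ.Realize (Sum.elim (fun _ : Fin 1 => u 0) z) := by
      have := hψ N (n + 2) (fun _ => u 0) z ⟨by omega,
        fun _ => (by omega : (u 0 : ℕ) + 2 ≤ n + 2), hpow (by omega)⟩
      rwa [h0] at this
    have hR (hle : ∀ i, v i ≤ (n + 2) ^ d) :
        R n v ↔ φ.Realize (Sum.elim u (Empty.elim : Empty → Fin N)) := by
      have := hφ N ((n + 2) ^ (d + 2)) u Empty.elim ⟨by omega, fun i => by
        refine Fin.cases ?_ (fun i => ?_) i
        · omega
        · have := hle i
          have := hv i
          omega, by rw [← pow_mul]; exact hpow (by omega)⟩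
      simp only [h0, hv] at this
      exact this
    simp only [Formula.realize_inf, Formula.realize_relabel, Formula.realize_iExs,
      Formula.realize_iInf, realize_le, e1, e2, Sum.elim_inl, Sum.elim_inr, hv, ← hz]
    constructor
    · rintro ⟨h1, z, hz, h2⟩
      rw [hz] at h2
      exact ⟨(hR h2).2 h1, h2⟩
    · rintro ⟨h1, h2⟩
      exact ⟨(hR h2).1 h1, fun _ => ⟨_, hdN⟩, rfl, h2⟩
  constructor
  · intro hR
    have hle := hb n v hR
    refine ⟨Fin.cons ⟨n, by have := hpow (a := 1) (by omega); rw [pow_one] at this; omega⟩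
      fun i => ⟨v i, (hle i).trans_lt hdN⟩, rfl, fun i => rfl, ?_⟩
    exact (key _ rfl fun i => rfl).2 ⟨hR, hle⟩
  · rintro ⟨u, h0, hv, hu⟩
    exact ((key u h0 hv).1 hu).1

end Relativization

/-! ### Logarithms by means of `BIT` -/

section Arithmetic

/-- The logarithm is the position of the highest digit 1. Such positions never exceed `x`, so a
bounded quantifier suffices. -/
theorem eq_log_iff {x : ℕ} (hx : x ≠ 0) (y : ℕ) :
    y = Nat.log 2 x ↔ x.testBit y = true ∧ ∀ i ≤ x, x.testBit i = true → i ≤ y := by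
  have hlog : x.testBit (Nat.log 2 x) = true ∧ ∀ i, x.testBit i = true → i ≤ Nat.log 2 x := by
    constructor
    · have h1 := Nat.pow_log_le_self 2 hx
      have h2 := Nat.lt_pow_succ_log_self (b := 2) (by norm_num) x
      have : x / 2 ^ Nat.log 2 x = 1 := by
        rw [Nat.div_eq_iff (by positivity)]
        rw [pow_succ] at h2
        omega
      rw [Nat.testBit_eq_decide_div_mod_eq, this]
      rfl
    · intro i hi
      exact Nat.le_log_of_pow_le (by norm_num) (Nat.ge_two_pow_of_testBit hi)
  constructor
  · rintro rfl
    exact ⟨hlog.1, fun i _ hi => hlog.2 i hi⟩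
  · rintro ⟨h1, h2⟩
    exact le_antisymm (hlog.2 y h1) (h2 _ (Nat.log_le_self 2 x) hlog.1)

theorem eq_two_pow_iff (y k : ℕ) :
    y = 2 ^ k ↔ y.testBit k = true ∧ ∀ i ≤ y, y.testBit i = true → i = k := by
  constructor
  · rintro rfl
    refine ⟨Nat.testBit_two_pow_self, fun i _ hi => ?_⟩
    rw [Nat.testBit_two_pow] at hi
    simpa [eq_comm] using hi
  · rintro ⟨h1, h2⟩
    refine Nat.eq_of_testBit_eq fun i => ?_
    rw [Nat.testBit_two_pow, Bool.eq_iff_iff, decide_eq_true_iff]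
    constructor
    · intro hi
      exact (h2 i (Nat.lt_two_pow_self.le.trans (Nat.ge_two_pow_of_testBit hi)) hi).symm
    · rintro rfl
      exact h1

variable {α : Type} [Finite α]

theorem PolyFun.log {f : (α → ℕ) → ℕ} (hf : PolyFun f) (h0 : ∀ v, f v ≠ 0) :
    PolyFun fun v => Nat.log 2 (f v) := by
  refine hf.of_le (fun v => Nat.log_le_self 2 _) (Def.congr ?_ fun w => eq_log_iff (h0 _) _)
  exact (Def.testBit hf.up (.var _)).and
    (Def.all hf.up ((Def.testBit hf.up.up (.var _)).imp (Def.le (.var _) (.var _))))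

/-- Exponentiation grows too fast in general, but this power is at most `f v`. -/
theorem PolyFun.two_pow_log {f : (α → ℕ) → ℕ} (hf : PolyFun f) (h0 : ∀ v, f v ≠ 0) :
    PolyFun fun v => 2 ^ Nat.log 2 (f v) := by
  refine hf.of_le (fun v => Nat.pow_log_le_self 2 (h0 v))
    (Def.congr ?_ fun w => eq_two_pow_iff _ _)
  have hl := hf.log h0
  exact (Def.testBit (.var _) hl.up).and
    (Def.all (.var _) ((Def.testBit (.var _) (.var _)).imp (Def.eq (.var _) hl.up.up)))

end Arithmetic

open CircuitFamily

/-! ### Paths as numbers -/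

section PathCode

theorem pathCode_append (π : List Bool) (b : Bool) :
    pathCode (π ++ [b]) = 2 * pathCode π + b.toNat := by
  simp [pathCode, List.foldl_append]

theorem pathCode_pos (π : List Bool) : 0 < pathCode π := by
  induction π using List.reverseRecOn with
  | nil => simp [pathCode]
  | append_singleton π b ih => rw [pathCode_append]; omega

theorem pathCode_lt (π : List Bool) : pathCode π < 2 ^ (π.length + 1) := by
  induction π using List.reverseRecOn with
  | nil => simp [pathCode]
  | append_singleton π b ih =>
    rw [pathCode_append, List.length_append, List.length_singleton, pow_succ]
    have := b.toNat_le
    omega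

theorem pathCode_injective : Function.Injective pathCode := by
  intro π
  induction π using List.reverseRecOn with
  | nil =>
    intro π' h
    rcases List.eq_nil_or_concat π' with rfl | ⟨π', b, rfl⟩
    · rfl
    · rw [List.concat_eq_append, pathCode_append] at h
      have := pathCode_pos π'
      simp only [pathCode, List.foldl_nil] at h this
      omega
  | append_singleton π b ih =>
    intro π' h
    rcases List.eq_nil_or_concat π' with rfl | ⟨π', b', rfl⟩
    · rw [pathCode_append] at h
      have := pathCode_pos π
      simp only [pathCode, List.foldl_nil] at h this
      omega
    · rw [List.concat_eq_append, pathCode_append, pathCode_append] at h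
      have h1 := b.toNat_le
      have h2 := b'.toNat_le
      rw [List.concat_eq_append, ih (a₂ := π') (by omega), show b = b' by cases b <;> cases b' <;> simp_all <;> omega]

/-- The last direction, from block `e`, becomes the lowest digit; the top digit is the leading 1 of
the code. -/
theorem testBit_pathCode_path (D e : ℕ) (β : ℕ → Bool) (i : ℕ) :
    (pathCode (path D e β)).testBit i = true ↔
      i < D + 1 - e ∧ β (8 * (e + i) + 4) = true ∨ i = D + 1 - e := by
  induction hk : D + 1 - e generalizing e i with
  | zero =>
    have : path D e β = [] := by simp [path, hk]
    rw [this]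
    simp [pathCode, Nat.testBit_one_eq_true_iff_self_eq_zero]
  | succ k ih =>
    rw [path_succ (by omega), pathCode_append]
    rcases i with _ | i
    · rw [Nat.testBit_zero]
      cases β (8 * e + 4) <;> simp
    · have : (2 * pathCode (path D (e + 1) β) + (β (8 * e + 4)).toNat) / 2 =
          pathCode (path D (e + 1) β) := by
        have := (β (8 * e + 4)).toNat_le
        omega
      rw [Nat.testBit_succ, this, ih (e + 1) i (by omega)]
      rw [show e + 1 + i = e + (i + 1) by omega]
      simp

theorem eq_pathCode_path_iff (z D e : ℕ) (β : ℕ → Bool) :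
    z = pathCode (path D e β) ↔ ∀ i ≤ z + (D + 1), (z.testBit i = true ↔
      i < D + 1 - e ∧ β (8 * (e + i) + 4) = true ∨ i = D + 1 - e) := by
  constructor
  · rintro rfl i -
    exact testBit_pathCode_path D e β i
  · intro h
    refine Nat.eq_of_testBit_eq fun i => ?_
    rw [Bool.eq_iff_iff, testBit_pathCode_path]
    rcases le_or_gt i (z + (D + 1)) with hi | hi
    · exact h i hi
    · rw [Nat.testBit_lt_two_pow ((by omega : z < i).trans Nat.lt_two_pow_self)]
      simp only [Bool.false_eq_true, false_iff]
      omega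

end PathCode

/-! ### Definability of the labels -/

section Labels

/-- The position of a bit in a block. -/
theorem PolyFun.block {α : Type} {e : (α → ℕ) → ℕ} (he : PolyFun e) (r : ℕ) : PolyFun fun v => 8 * e v + r :=
  ((PolyFun.const 8).mul he).add (.const r)

theorem Def.bit {α : Type} {p e : (α → ℕ) → ℕ} (hp : PolyFun p) (he : PolyFun e) (r : ℕ) :
    Def fun v => (p v).testBit (8 * e v + r) = true :=
  Def.testBit hp (he.block r)

theorem Def.bit_false {α : Type} {p e : (α → ℕ) → ℕ} (hp : PolyFun p) (he : PolyFun e) (r : ℕ) :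
    Def fun v => (p v).testBit (8 * e v + r) = false :=
  Def.testBit_false hp (he.block r)

variable {α : Type} [Finite α]

theorem PolyFun.sub {f g : (α → ℕ) → ℕ} (hf : PolyFun f) (hg : PolyFun g) :
    PolyFun fun v => f v - g v :=
  hf.of_le (fun v => Nat.sub_le _ _) <|
    ((Def.eq ((PolyFun.var none).add hg.up) hf.up).or
      ((Def.le hf.up hg.up).and (Def.eq (.var none) (.const 0)))).congr fun w => by omega

theorem Def.all_lt {g : (α → ℕ) → ℕ} (hg : PolyFun g) {P : (α → ℕ) → ℕ → Prop}
    (hP : Def fun w : Option α → ℕ => P (fun i => w (some i)) (w none)) :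
    Def fun v => ∀ x, 1 ≤ x → x < g v → P v x :=
  (Def.all (P := fun v x => 1 ≤ x → x < g v → P v x) hg
    ((Def.le (.const 1) (.var none)).imp ((Def.lt (.var none) hg.up).imp hP))).congr
    fun _ => ⟨fun h x _ h1 h2 => h x h1 h2, fun h x h1 h2 => h x h2.le h1 h2⟩

variable {D e p q z t : (α → ℕ) → ℕ}

theorem def_alive (hD : PolyFun D) (he : PolyFun e) (hp : PolyFun p) :
    Def fun v => Alive (D v) (e v) (p v).testBit := by
  refine Def.congr (Def.all hD (P := fun v e' => e v ≤ e' → CopyBlock (p v).testBit e')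
    ((Def.le he.up (.var none)).imp ?_)) fun v =>
      ⟨fun h e' h1 h2 => h e' h2 h1, fun h e' h1 h2 => h e' h2 h1⟩
  have hb := PolyFun.var (none : Option α)
  exact (Def.bit_false hp.up hb 8).and ((Def.bit hp.up hb 7).and ((Def.bit hp.up hb 5).and
    ((Def.bit hp.up hb 3).and ((Def.bit hp.up hb 2).and (Def.bit_false hp.up hb 1)))))

theorem def_innerSeries (hD : PolyFun D) (ht : PolyFun t) (hp : PolyFun p) :
    Def fun v => InnerSeries (D v) (t v) (p v).testBit := by
  have hb := PolyFun.var (none : Option α)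
  refine Def.ex hD ((def_alive hD.up (hb.add (.const 1)) hp.up).and
    ((Def.bit_false hp.up hb 8).and ?_))
  exact (Def.eq ht.up (hb.block 7)).or
    (((Def.eq ht.up (hb.block 5)).and ((Def.bit hp.up hb 7).and (Def.bit hp.up hb 6))).or
      (((Def.eq ht.up (hb.block 3)).and ((Def.bit hp.up hb 7).and
        ((Def.bit hp.up hb 5).and (Def.bit hp.up hb 4)))).or
      ((Def.eq ht.up (hb.block 2)).and ((Def.bit hp.up hb 7).and
        ((Def.bit hp.up hb 5).and ((Def.bit hp.up hb 4).and (Def.bit hp.up hb 3)))))))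

theorem def_pathCode_path (hz : PolyFun z) (hD : PolyFun D) (he : PolyFun e) (hp : PolyFun p) :
    Def fun v => z v = pathCode (path (D v) (e v) (p v).testBit) := by
  refine Def.congr ?_ fun v => eq_pathCode_path_iff _ _ _ _
  have hi := PolyFun.var (none : Option α)
  have hL : PolyFun fun v => D v + 1 - e v := (hD.add (.const 1)).sub he
  exact Def.all (hz.add (hD.add (.const 1))) ((Def.testBit hz.up hi).iff
    (((Def.lt hi hL.up).and (Def.bit hp.up (he.up.add hi) 4)).or (Def.eq hi hL.up)))

theorem def_outConst (hD : PolyFun D) (hp : PolyFun p) {K : (α → ℕ) → List Bool → Prop}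
    (hK : Def fun w : Option α → ℕ => K (fun i => w (some i))
      (path (D fun i => w (some i)) (w none + 1) (p fun i => w (some i)).testBit)) :
    Def fun v => OutConst (D v) (p v).testBit (K v) := by
  have hb := PolyFun.var (none : Option α)
  exact Def.ex hD ((def_alive hD.up (hb.add (.const 1)) hp.up).and
    ((Def.all_lt (hb.block 8) (Def.testBit_false hp.up.up (.var none))).and
      ((Def.bit hp.up hb 8).and hK)))

/-- The conjunct with `D` in `hA` costs nothing under the bounded quantifier. It is what `path_succ`
requires to read a path followed by a direction as a path that ends one block lower. -/
theorem def_predConst (hD : PolyFun D) (hp : PolyFun p) {A : (α → ℕ) → List Bool → Bool → Prop}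
    (hA : Def fun w : Option α → ℕ => w none ≤ (D fun i => w (some i)) ∧ A (fun i => w (some i))
      (path (D fun i => w (some i)) (w none + 1) (p fun i => w (some i)).testBit)
      ((p fun i => w (some i)).testBit (8 * w none + 4))) :
    Def fun v => PredConst (D v) (p v).testBit (A v) := by
  have hb := PolyFun.var (none : Option α)
  refine Def.congr (Def.ex hD (P := fun v e => Alive (D v) (e + 1) (p v).testBit ∧
      (∀ i, 1 ≤ i → i < 8 * e + 1 → (p v).testBit i = false) ∧
      (p v).testBit (8 * e + 8) = false ∧ (p v).testBit (8 * e + 7) = true ∧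
      (p v).testBit (8 * e + 5) = true ∧ (p v).testBit (8 * e + 3) = true ∧
      (p v).testBit (8 * e + 2) = true ∧ (p v).testBit (8 * e + 1) = true ∧
      e ≤ D v ∧ A v (path (D v) (e + 1) (p v).testBit) ((p v).testBit (8 * e + 4)))
    ((def_alive hD.up (hb.add (.const 1)) hp.up).and
    ((Def.all_lt (hb.block 1) (Def.testBit_false hp.up.up (.var none))).and
    ((Def.bit_false hp.up hb 8).and ((Def.bit hp.up hb 7).and ((Def.bit hp.up hb 5).and
      ((Def.bit hp.up hb 3).and ((Def.bit hp.up hb 2).and ((Def.bit hp.up hb 1).and hA)))))))))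
    fun v => exists_congr fun e => ?_
  exact ⟨fun ⟨h0, h1, h2, h3, h4, h5, h6, h7, h8, h9⟩ => ⟨h0, h1, h2, h3, h4, h5, h6, h7, h8, h0, h9⟩,
    fun ⟨h0, h1, h2, h3, h4, h5, h6, h7, h8, _, h9⟩ => ⟨h0, h1, h2, h3, h4, h5, h6, h7, h8, h9⟩⟩

theorem def_agree (hp : PolyFun p) (hq : PolyFun q) (ht : PolyFun t) :
    Def fun v => ∀ i, t v < i → (p v).testBit i = (q v).testBit i := by
  have hi := PolyFun.var (none : Option α)
  refine Def.congr (Def.all (hp.add hq) ((Def.lt ht.up hi).imp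
    ((Def.testBit hp.up hi).iff (Def.testBit hq.up hi)))) fun v =>
      ⟨fun h i _ hi => Bool.eq_iff_iff.1 (h i hi), fun h i hi => ?_⟩
  rcases le_or_gt i (p v + q v) with h1 | h1
  · exact Bool.eq_iff_iff.2 (h i h1 hi)
  · rw [Nat.testBit_lt_two_pow ((by omega : p v < i).trans Nat.lt_two_pow_self),
      Nat.testBit_lt_two_pow ((by omega : q v < i).trans Nat.lt_two_pow_self)]

theorem def_treeLt (hp : PolyFun p) (hq : PolyFun q) {S : (α → ℕ) → ℕ → (ℕ → Bool) → Prop}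
    (hS : Def fun w : Option α → ℕ => S (fun i => w (some i)) (w none)
      (p fun i => w (some i)).testBit) :
    Def fun v => treeLt (S v) (p v).testBit (q v).testBit := by
  have ht := PolyFun.var (none : Option α)
  refine Def.congr (Def.ex hq (P := fun v t => (∀ i, t < i → (p v).testBit i = (q v).testBit i) ∧
    (p v).testBit t = false ∧ (q v).testBit t = true ∧ S v t (p v).testBit)
    ((def_agree hp.up hq.up ht).and
    ((Def.testBit_false hp.up ht).and ((Def.testBit hq.up ht).and hS)))) fun v =>
      exists_congr fun t => ?_
  refine ⟨fun h => ⟨?_, h⟩, fun h => h.2⟩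
  -- Digit `t` of `q` is 1, hence `t ≤ q`, and `q` can bound the quantifier.
  exact Nat.lt_two_pow_self.le.trans (Nat.ge_two_pow_of_testBit h.2.2.1)

end Labels

/-! ### The uniform circuit family of the reduction -/

section Family

variable {F : CircuitFamily}

theorem pathRel_iff {n : ℕ} (g : Fin (F n).size) (π : List Bool) (h : ℕ) :
    F.PathRel n ![g, pathCode π, h] ↔
      ∃ h' : Fin (F n).size, (F n).follow g π = some h' ∧ h = h' := by
  constructor
  · rintro ⟨g', h', π', hf, h1, h2, h3⟩
    obtain rfl : g = g' := Fin.ext h1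
    obtain rfl : π = π' := pathCode_injective h2
    exact ⟨h', hf, h3⟩
  · rintro ⟨h', hf, rfl⟩
    exact ⟨g, h', π, hf, rfl, rfl, rfl⟩

theorem kindRel_iff {n : ℕ} (h : Fin (F n).size) (a b : ℕ) :
    F.KindRel n ![h, a, b] ↔ ((F n).gate h).kind.1 = a ∧ ((F n).gate h).kind.2 = b := by
  constructor
  · rintro ⟨h', h1, h2, h3⟩
    obtain rfl : h = h' := Fin.ext h1
    exact ⟨h2.symm, h3.symm⟩
  · rintro ⟨rfl, rfl⟩
    exact ⟨h, rfl, rfl, rfl⟩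

theorem kindRel_of_ne_zero {n : ℕ} (h : Fin (F n).size) {a : ℕ} (ha : a ≠ 0) :
    F.KindRel n ![h, a, 0] ↔ ((F n).gate h).kind.1 = a := by
  rw [kindRel_iff, and_iff_left_iff_imp]
  rintro rfl
  rcases hg : (F n).gate h with i | _ | _ | _
  · simp [hg, Gate.kind] at ha
  all_goals rfl

/-- The only output gate. -/
def outGate (h1 : ∀ n, (F n).outs.length = 1) (n : ℕ) : Fin (F n).size :=
  (F n).outs.get ⟨0, by rw [h1]; exact one_pos⟩

theorem outs_eq (h1 : ∀ n, (F n).outs.length = 1) (n : ℕ) : (F n).outs = [outGate h1 n] := by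
  obtain ⟨g, hg⟩ := List.length_eq_one_iff.1 (h1 n)
  simp [outGate, hg]

theorem outRel_iff (h1 : ∀ n, (F n).outs.length = 1) (n g : ℕ) :
    F.OutRel n ![0, g] ↔ g = outGate h1 n := by
  constructor
  · rintro ⟨j, hj, hg⟩
    have : j = ⟨0, by rw [h1]; exact one_pos⟩ := Fin.ext hj.symm
    subst this
    exact hg
  · rintro rfl
    exact ⟨⟨0, by rw [h1]; exact one_pos⟩, rfl, rfl⟩

/-- The bound on the depth of the circuits. -/
def depth (c n : ℕ) : ℕ := c * Nat.log 2 (n + 2)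

/-- The number of points of the poset. -/
def points (c n : ℕ) : ℕ := 2 ^ (8 * (depth c n + 1) + 1)

/-- This form is a polynomial in `2 ^ Nat.log 2 (n + 2)`, from which both the size bound and
definability follow. -/
theorem points_eq (c n : ℕ) : points c n = (2 ^ Nat.log 2 (n + 2)) ^ (8 * c) * 2 ^ 9 := by
  rw [points, depth, ← pow_mul, ← pow_add]
  congr 1
  ring

theorem points_le (c n : ℕ) : points c n ≤ (n + 2) ^ (8 * c + 9) := by
  rw [points_eq, pow_add]
  exact Nat.mul_le_mul (Nat.pow_le_pow_left (Nat.pow_log_le_self 2 (by omega)) _)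
    (Nat.pow_le_pow_left (by omega) _)

theorem pathCode_path_le (c n e : ℕ) (β : ℕ → Bool) :
    pathCode (path (depth c n) e β) ≤ points c n :=
  (pathCode_lt _).le.trans (Nat.pow_le_pow_right (by norm_num) (by rw [length_path]; omega))

variable {α : Type} [Finite α] {n e p q i : (α → ℕ) → ℕ}

theorem PolyFun.depth (c : ℕ) (hn : PolyFun n) : PolyFun fun v => depth c (n v) :=
  (PolyFun.const c).mul ((hn.add (.const 2)).log fun v => by omega)

theorem PolyFun.points (c : ℕ) (hn : PolyFun n) : PolyFun fun v => points c (n v) := by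
  simp only [points_eq]
  exact (((hn.add (.const 2)).two_pow_log fun v => by omega).pow _).mul (.const _)

theorem def_ternary {α : Type} {n : (α → ℕ) → ℕ} {R : ℕ → (Fin 3 → ℕ) → Prop} (hR : FODefinable R) (hn : PolyFun n)
    {a b c : (α → ℕ) → ℕ} (ha : PolyFun a) (hb : PolyFun b) (hc : PolyFun c) :
    Def fun v => R (n v) ![a v, b v, c v] :=
  ((FODefinable.def hR).comp (f := ![n, a, b, c])
    (by simp [Fin.forall_fin_succ, hn, ha, hb, hc])).congr fun v => by
      refine iff_of_eq (congrArg _ (funext fun i => ?_))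
      fin_cases i <;> rfl

theorem def_binary {α : Type} {n : (α → ℕ) → ℕ} {R : ℕ → (Fin 2 → ℕ) → Prop} (hR : FODefinable R) (hn : PolyFun n)
    {a b : (α → ℕ) → ℕ} (ha : PolyFun a) (hb : PolyFun b) :
    Def fun v => R (n v) ![a v, b v] :=
  ((FODefinable.def hR).comp (f := ![n, a, b])
    (by simp [Fin.forall_fin_succ, hn, ha, hb])).congr fun v => by
      refine iff_of_eq (congrArg _ (funext fun i => ?_))
      fin_cases i <;> rfl

theorem def_kind (hU : F.ExtUniform) (hn : PolyFun n) (a : ℕ) (hi : PolyFun i) :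
    Def fun w : Option α → ℕ =>
      F.KindRel (n fun i => w (some i)) ![w none, a, i fun i => w (some i)] :=
  def_ternary hU.1 hn.up (.var none) (.const a) hi.up

variable (h1 : ∀ n, (F n).outs.length = 1) {s : ℕ} (hs : ∀ n, (F n).size ≤ (n + 2) ^ s)
  (hU : F.ExtUniform) (c : ℕ)

include hs hU

theorem PolyFun.outGate (hn : PolyFun n) : PolyFun fun v => (outGate h1 (n v) : ℕ) :=
  ((hn.add (.const 2)).pow s).of_le (fun v => (PosetGame.outGate h1 (n v)).2.le.trans (hs _))
    ((def_binary hU.2.2 hn.up (.const 0) (.var none)).congr fun _ => (outRel_iff h1 _ _).symm)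

/-- The extended connection language enters here: the code of a path of logarithmic length is
polynomially bounded and can be quantified, and `PathRel` gives its end without tracing the
intermediate gates. -/
theorem def_follow (hn : PolyFun n) (he : PolyFun e) (hp : PolyFun p) {Q : (α → ℕ) → ℕ → Prop}
    (hQ : Def fun w : Option α → ℕ => Q (fun i => w (some i)) (w none)) :
    Def fun v => ∃ h : Fin (F (n v)).size, (F (n v)).follow (outGate h1 (n v))
      (path (depth c (n v)) (e v) (p v).testBit) = some h ∧ Q v h := by
  have hz := PolyFun.var (none : Option (Option α))
  refine Def.congr (Def.ex ((hn.add (.const 2)).pow s)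
    (P := fun v h => (∃ z ≤ points c (n v), z = pathCode (path (depth c (n v)) (e v)
      (p v).testBit) ∧ F.PathRel (n v) ![outGate h1 (n v), z, h]) ∧ Q v h)
    ((Def.ex (hn.points c).up ((def_pathCode_path hz (hn.depth c).up.up he.up.up hp.up.up).and
      (def_ternary hU.2.1 hn.up.up (PolyFun.outGate h1 hs hU hn).up.up hz
        (.var (some none))))).and hQ)) fun v => ?_
  constructor
  · rintro ⟨h, hf, hq⟩
    exact ⟨h, h.2.le.trans (hs _), ⟨_, pathCode_path_le _ _ _ _, rfl,
      (pathRel_iff _ _ _).2 ⟨h, hf, rfl⟩⟩, hq⟩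
  · rintro ⟨h, -, ⟨z, -, rfl, hr⟩, hq⟩
    obtain ⟨h', hf, rfl⟩ := (pathRel_iff _ _ _).1 hr
    exact ⟨h', hf, hq⟩

theorem def_negatedAt (hn : PolyFun n) (he : PolyFun e) (hp : PolyFun p) :
    Def fun v => NegatedAt (F (n v)) (outGate h1 (n v))
      (path (depth c (n v)) (e v) (p v).testBit) :=
  (def_follow h1 hs hU c hn he hp
    (Q := fun v h => F.KindRel (n v) ![h, 1, 0] ∨ F.KindRel (n v) ![h, 2, 0])
    ((def_kind hU hn 1 (.const 0)).or (def_kind hU hn 2 (.const 0)))).congr fun v => by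
      simp only [kindRel_of_ne_zero _ one_ne_zero, kindRel_of_ne_zero _ two_ne_zero, NegatedAt]

theorem def_inputAt (hn : PolyFun n) (he : PolyFun e) (hp : PolyFun p) (hi : PolyFun i) :
    Def fun v => InputAt (F (n v)) (outGate h1 (n v))
      (path (depth c (n v)) (e v) (p v).testBit) (i v) :=
  (def_follow h1 hs hU c hn he hp (Q := fun v h => F.KindRel (n v) ![h, 0, i v])
    (def_kind hU hn 0 hi)).congr fun v => by
    simp only [kindRel_iff, InputAt]

theorem def_predNegatedAt (hn : PolyFun n) (he : PolyFun e) (hp : PolyFun p) :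
    Def fun v => e v ≤ depth c (n v) ∧ PredNegatedAt (F (n v)) (outGate h1 (n v))
      (path (depth c (n v)) (e v + 1) (p v).testBit) ((p v).testBit (8 * e v + 4)) :=
  ((Def.le he (hn.depth c)).and ((def_follow h1 hs hU c hn (he.add (.const 1)) hp
    (Q := fun v h => F.KindRel (n v) ![h, 2, 0]) (def_kind hU hn 2 (.const 0))).and (def_follow h1 hs hU c hn he hp
      (Q := fun _ h => h = h) (Def.eq (.var none) (.var none))))).congr fun v => by
        refine and_congr_right fun hle => ?_
        rw [path_succ hle]
        simp only [kindRel_of_ne_zero _ two_ne_zero, PredNegatedAt, and_true]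
        exact ⟨fun ⟨h, h1, h2, h3⟩ => ⟨⟨h, h1, h2⟩, h3⟩, fun ⟨⟨h, h1, h2⟩, h3⟩ => ⟨h, h1, h2, h3⟩⟩

theorem def_staticLe (hn : PolyFun n) (hp : PolyFun p) (hq : PolyFun q) :
    Def fun v => StaticLe (depth c (n v)) (F (n v)) (outGate h1 (n v)) (p v) (q v) := by
  have hb := PolyFun.var (none : Option (Option α))
  refine (Def.eq hp hq).or (def_treeLt hp hq
    ((def_innerSeries (hn.depth c).up (.var none) hp.up).or
      ((Def.eq (.var none) (.const 0)).and ((def_outConst (hn.depth c).up hp.up ?_).or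
        (def_predConst (hn.depth c).up hp.up ?_)))))
  · exact def_negatedAt h1 hs hU c hn.up.up (hb.add (.const 1)) hp.up.up
  · exact def_predNegatedAt h1 hs hU c hn.up.up hb hp.up.up

theorem def_inputLe (hn : PolyFun n) (hp : PolyFun p) (hq : PolyFun q) (hi : PolyFun i) :
    Def fun v => InputLe (depth c (n v)) (F (n v)) (outGate h1 (n v)) (p v) (q v) (i v) :=
  (def_agree hp hq (.const 0)).and ((Def.testBit_false hp (.const 0)).and
    ((Def.testBit hq (.const 0)).and (def_outConst (hn.depth c) hp
      (def_inputAt h1 hs hU c hn.up ((PolyFun.var none).add (.const 1)) hp.up hi.up))))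

omit hs hU in
/-- The circuits of the reduction. -/
noncomputable abbrev reductionFamily : CircuitFamily := fun n =>
  reductionCircuit (depth c n) (F n) (outGate h1 n)

theorem def_entryGate (hn : PolyFun n) (hp : PolyFun p) (hq : PolyFun q) (hi : PolyFun i) :
    Def fun v => i v = (entryGate (depth c (n v)) (F (n v)) (outGate h1 (n v)) (p v) (q v) : ℕ) := by
  have hS := def_staticLe h1 hs hU c hn hp hq
  refine Def.congr ((hS.and (Def.eq hi hn)).or (hS.not.and
    (((Def.lt hi hn).and (def_inputLe h1 hs hU c hn hp hq hi)).or
      ((Def.ex hn (P := fun v j => j < n v ∧ InputLe (depth c (n v)) (F (n v))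
        (outGate h1 (n v)) (p v) (q v) j) ((Def.lt (.var none) hn.up).and
          (def_inputLe h1 hs hU c hn.up hp.up hq.up (.var none)))).not.and
        (Def.eq hi (hn.add (.const 1))))))) fun v => ?_
  rw [entryGate_eq_iff]
  refine or_congr_right (and_congr_right fun _ => or_congr_right (and_congr_left fun _ =>
    not_congr ⟨fun ⟨j, h1, h2⟩ => ⟨j, h1.le, h1, h2⟩, fun ⟨j, _, h1, h2⟩ => ⟨j, h1, h2⟩⟩))

omit hs hU in
theorem kindRel_reductionFamily (n : ℕ) (v : Fin 3 → ℕ) :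
    (reductionFamily h1 c).KindRel n v ↔ (v 0 < n ∧ v 1 = 0 ∧ v 2 = v 0) ∨
      (v 0 = n ∧ v 1 = 2 ∧ v 2 = 0) ∨ (v 0 = n + 1 ∧ v 1 = 3 ∧ v 2 = 0) := by
  constructor
  · rintro ⟨⟨g, hg⟩, h0, h2, h3⟩
    change g < n + 2 at hg
    simp only at h0
    dsimp only at h2 h3
    split_ifs at h2 h3 with h4 h5
    · exact .inl ⟨by omega, h2, by rw [h3, h0]; rfl⟩
    · exact .inr (.inl ⟨by omega, h2, h3⟩)
    · exact .inr (.inr ⟨by omega, h2, h3⟩)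
  · rintro (⟨h0, h2, h3⟩ | ⟨h0, h2, h3⟩ | ⟨h0, h2, h3⟩)
    · exact ⟨⟨v 0, by change v 0 < n + 2; omega⟩, rfl, by simp [h0, h2, Gate.kind],
        by simp [h0, h3, Gate.kind]⟩
    · exact ⟨⟨v 0, by change v 0 < n + 2; omega⟩, rfl, by simp [h0, h2, Gate.kind],
        by simp [h0, h3, Gate.kind]⟩
    · exact ⟨⟨v 0, by change v 0 < n + 2; omega⟩, rfl, by simp [h0, h2, Gate.kind],
        by simp [h0, h3, Gate.kind]⟩

omit hs hU in
-- Row and column are quantified with bounds instead of being computed by division, which keeps the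
-- description within the calculus.
theorem outRel_reductionFamily (n : ℕ) (v : Fin 2 → ℕ) :
    (reductionFamily h1 c).OutRel n v ↔ ∃ p ≤ points c n, ∃ q ≤ points c n,
      (p < points c n ∧ q < points c n) ∧ v 0 = p * points c n + q ∧
        v 1 = (entryGate (depth c n) (F n) (outGate h1 n) p q : ℕ) := by
  constructor
  · rintro ⟨⟨j, hj⟩, h0, h2⟩
    have hj' : j < points c n * points c n := by simpa [points] using hj
    have hpos : 0 < points c n := by unfold points; positivity
    have hp : j / points c n < points c n := Nat.div_lt_of_lt_mul hj'
    have hq : j % points c n < points c n := Nat.mod_lt _ hpos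
    refine ⟨j / points c n, hp.le, j % points c n, hq.le, ⟨hp, hq⟩, ?_, ?_⟩
    · rw [h0, Nat.div_add_mod']
    · rw [h2]
      simp only [List.get_eq_getElem, List.getElem_ofFn]
      rfl
  · rintro ⟨p, -, q, -, ⟨hp, hq⟩, h0, h2⟩
    have hlt : v 0 < points c n * points c n := by
      rw [h0]
      nlinarith
    refine ⟨⟨v 0, by simpa [points] using hlt⟩, rfl, h2.trans ?_⟩
    have hp' : v 0 / points c n = p := by
      rw [h0, mul_comm, Nat.mul_add_div (by omega), Nat.div_eq_of_lt hq, add_zero]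
    have hq' : v 0 % points c n = q := by
      rw [h0, Nat.mul_add_mod', Nat.mod_eq_of_lt hq]
    have key : entryGate (depth c n) (F n) (outGate h1 n) p q =
        entryGate (depth c n) (F n) (outGate h1 n) (v 0 / points c n) (v 0 % points c n) := by
      rw [hp', hq']
    refine (congrArg Fin.val key).trans ?_
    simp only [List.get_eq_getElem, List.getElem_ofFn]
    rfl

theorem uniform_reductionFamily : (reductionFamily h1 c).Uniform := by
  refine ⟨Def.foDefinable ?_ ⟨2, fun n v h i => ?_⟩, Def.foDefinable ?_ ⟨0, ?_⟩, Def.foDefinable ?_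
    ⟨2 * (8 * c + 9) + 1, fun n v h i => ?_⟩⟩
  · have v0 := PolyFun.var (0 : Fin 4)
    have vg := PolyFun.var (1 : Fin 4)
    have vt := PolyFun.var (2 : Fin 4)
    have vi := PolyFun.var (3 : Fin 4)
    exact Def.congr (((Def.lt vg v0).and ((Def.eq vt (.const 0)).and (Def.eq vi vg))).or
      (((Def.eq vg v0).and ((Def.eq vt (.const 2)).and (Def.eq vi (.const 0)))).or
        ((Def.eq vg (v0.add (.const 1))).and ((Def.eq vt (.const 3)).and
          (Def.eq vi (.const 0)))))) fun v => kindRel_reductionFamily h1 c _ _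
  · rw [kindRel_reductionFamily] at h
    have : n + 4 ≤ (n + 2) ^ 2 := by nlinarith
    fin_cases i <;> simp only [Fin.zero_eta, Fin.mk_one, Fin.reduceFinMk] <;> omega
  -- There are no wires, so a contradictory formula defines them.
  · refine (Def.lt (.const 0) (.const 0)).congr fun v => ?_
    simp only [lt_irrefl, iff_false]
    rintro ⟨g, h, hh, -⟩
    dsimp only at hh
    split_ifs at hh <;> simp [Gate.preds] at hh
  · rintro n v ⟨g, h, hh, -⟩
    dsimp only at hh
    split_ifs at hh <;> simp [Gate.preds] at hh
  · have v0 := PolyFun.var (0 : Fin 3)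
    have hm := v0.points c
    have hp := PolyFun.var (some none : Option (Option (Fin 3)))
    have hq := PolyFun.var (none : Option (Option (Fin 3)))
    refine Def.congr ?_ fun v => outRel_reductionFamily h1 c _ _
    exact Def.ex hm (Def.ex hm.up (((Def.lt hp hm.up.up).and (Def.lt hq hm.up.up)).and
      ((Def.eq (.var (some (some 1))) ((hp.mul hm.up.up).add hq)).and
        (def_entryGate h1 hs hU c v0.up.up hp hq (.var (some (some 2)))))))
  · obtain ⟨p, -, q, -, ⟨hp, hq⟩, h0, h2⟩ := (outRel_reductionFamily h1 c n v).1 h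
    have hm := points_le c n
    have hm2 : points c n * points c n ≤ (n + 2) ^ (2 * (8 * c + 9)) := by
      rw [two_mul, pow_add]
      exact Nat.mul_le_mul hm hm
    have h3 : (n + 2) ^ (2 * (8 * c + 9)) ≤ (n + 2) ^ (2 * (8 * c + 9) + 1) :=
      Nat.pow_le_pow_right (by omega) (by omega)
    have h4 : n + 2 ≤ (n + 2) ^ (2 * (8 * c + 9) + 1) := Nat.le_self_pow (by omega) _
    have h5 := (entryGate (depth c n) (F n) (outGate h1 n) p q).2
    have h6 : v 0 ≤ points c n * points c n := by
      rw [h0]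
      nlinarith
    fin_cases i <;> simp only [Fin.zero_eta, Fin.mk_one] <;> omega

end Family

theorem run_reductionFamily {F : CircuitFamily} (h1 : ∀ n, (F n).outs.length = 1) (c : ℕ)
    (w : List Bool) : (reductionFamily h1 c).run w =
      encodeOrder (reductionOrder (depth c w.length) (F w.length) (outGate h1 w.length) w.get) :=
  output_reductionCircuit _ _ _ _

end PosetGame

/-- `N-Free(Explicit, PO)` is `NC¹`-hard under `AC⁰` reductions. -/
theorem mainTheorem6 : PosetGame.AC0Hard PosetGame.NC1 PosetGame.nFreeExplicitPO := by
  open PosetGame in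
  rintro L ⟨F, hU, ⟨s, hs⟩, hF, ⟨c, hc⟩, h1, hL⟩
  refine ⟨(reductionFamily h1 c).run, ⟨reductionFamily h1 c, uniform_reductionFamily h1 hs hU c,
    ⟨1, fun n => ?_⟩, ⟨0, fun _ _ => le_rfl⟩, fun _ => rfl⟩, fun w => ⟨?_, ?_⟩⟩
  · rw [pow_one]
  · exact ⟨_, _, run_reductionFamily h1 c w, nFree_reductionOrder _ _ _ _⟩
  · rw [hL]
    have hw : F.run w = [true] ↔ (F w.length).eval w.get (outGate h1 w.length) = true := by
      rw [CircuitFamily.run, Circuit.output, outs_eq h1]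
      simp
    rw [hw, ← isExistsGame_reductionOrder (depth c w.length) _ _ (hF _) (hc _ _)]
    constructor
    · exact fun h => ⟨_, _, run_reductionFamily h1 c w, h⟩
    · rintro ⟨m, P, he, h⟩
      rw [run_reductionFamily] at he
      exact (encodeOrder_injective he).2 h
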